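/- All algebras are over $\mathbb{C}$, possibly without identity, with non-degenerate product (if $ab=0$ for all $b$, or $ba=0$ for all $b$, then $a=0$). $M(A)$ denotes the multiplier algebra of $A$, and $\iota$ the identity map. A multiplier Hopf algebra is a pair $(A,\Delta)$ where $\Delta:A\to M(A\otimes A)$ is a homomorphism such that $\Delta(a)(1\otimes b)$ and $(a\otimes 1)\Delta(b)$ lie in $A\otimes A$ for all $a,b\in A$, which is coassociative, i.e. $(a\otimes1\otimes1)(\Delta\otimes\iota)(\Delta(b)(1\otimes c))=(\iota\otimes\Delta)((a\otimes1)\Delta(b))(1\otimes1\otimes c)$ for all $a,b,c\in A$, and for which the linear maps $a\otimes b\mapsto\Delta(a)(1\otimes b)$ and $a\otimes b\mapsto(a\otimes1)\Delta(b)$ are bijections of $A\otimes A$. It is regular if $(A,\sigma\Delta)$ is also a multiplier Hopf algebra, where $\sigma$ is the flip. For a group $G$, it is $G$-cograded if there is a family $(A_p)_{p\in G}$ of non-zero subalgebras of $A$ with $A=\bigoplus_{p\in G}A_p$, $A_pA_q=0$ for $p\neq q$, and $\Delta(A_{pq})(1\otimes A_q)=A_p\otimes A_q=(A_p\otimes1)\Delta(A_{pq})$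 for all $p,q\in G$ (products of subspaces being linear spans of products of elements). Then $M(A\otimes A)=\prod_{p,q}M(A_p\otimes A_q)$, and $\Delta_{p,q}:A_{pq}\to M(A_p\otimes A_q)$ denotes the $(p,q)$-component of the restriction of $\Delta$ to $A_{pq}$. A left integral on a regular multiplier Hopf algebra $(A,\Delta)$ is a non-zero linear functional $\varphi$ on $A$ such that $(\iota\otimes\varphi)\Delta(a)=\varphi(a)1$ in $M(A)$ for all $a\in A$, that is, $(\iota\otimes\varphi)(\Delta(a)(b\otimes1))=\varphi(a)b=(\iota\otimes\varphi)((b\otimes1)\Delta(a))$ for all $a,b\in A$. **Proposition 2.4.** Let $(A,\Delta)$ be a regular $G$-cograded multiplier Hopf algebra with decomposition $A=\bigoplus_{p\in G}A_p$, let $\varphi$ be a left integral on $A$, and let $\varphi_p$ be the restriction of $\varphi$ to $A_p$. Then every $\varphi_p$ is faithful: for $a\in A_p$, if $\varphi_p(ab)=0$ for all $b\in A_p$, or if $\varphi_p(ba)=0$ for all $b\in A_p$, then $a=0$. Moreover, for all $p,q\in G$ and all $a\in A_{pq}$, $$(\iota\otimes\varphi_q)(\Delta_{p,q}(a))=\varphi_{pq}(a)\,1_p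 ,$$ where $1_p$ is the identity of $M(A_p)$. This is an equality in $M(A_p)$: for all $b\in A_p$, the multipliers $\Delta_{p,q}(a)(b\otimes1)$ and $(b\otimes1)\Delta_{p,q}(a)$ belong to $A_p\otimes A_q$, and $\iota\otimes\varphi_q$ maps both to $\varphi_{pq}(a)b$. -/

import Mathlib

open scoped TensorProduct

noncomputable section

/-- The product of `A` is non-degenerate. -/
def NondegenerateProduct (A : Type*) [NonUnitalRing A] : Prop :=
  (∀ a : A, (∀ b : A, a * b = 0) → a = 0) ∧ (∀ a : A, (∀ b : A, b * a = 0) → a = 0)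

theorem tensor_ext₂ {A B C : Type*} [AddCommGroup A] [Module ℂ A] [AddCommGroup B] [Module ℂ B]
    [AddCommGroup C] [Module ℂ C] {f g : A ⊗[ℂ] B →ₗ[ℂ] A ⊗[ℂ] B →ₗ[ℂ] C}
    (h : ∀ a b a' b', f (a ⊗ₜ b) (a' ⊗ₜ b') = g (a ⊗ₜ b) (a' ⊗ₜ b')) (x y : A ⊗[ℂ] B) :
    f x y = g x y := by
  have : f = g := by
    ext a b a' b'
    exact h a b a' b'
  rw [this]

section MultiplierAlgebra

variable (A : Type*) [NonUnitalRing A] [Module ℂ A] [IsScalarTower ℂ A A] [SMulCommClass ℂ A A]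

/-- The multipliers `(L, R)` of `A` (think of `L b = m b` and `R b = b m`), as a unital subalgebra
of `End A × (End A)ᵐᵒᵖ`; hence the product is `(L, R) (L', R') = (L ∘ L', R' ∘ R)`. -/
def multiplierSubalgebra : Subalgebra ℂ (Module.End ℂ A × (Module.End ℂ A)ᵐᵒᵖ) where
  carrier := {x | (∀ a b : A, x.1 (a * b) = x.1 a * b) ∧
    (∀ a b : A, x.2.unop (a * b) = a * x.2.unop b) ∧
    ∀ a b : A, x.2.unop a * b = a * x.1 b}
  mul_mem' := by
    rintro ⟨L, R⟩ ⟨L', R'⟩ ⟨h1, h2, h3⟩ ⟨h1', h2', h3'⟩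
    refine ⟨fun a b => ?_, fun a b => ?_, fun a b => ?_⟩ <;> simp_all
  add_mem' := by
    rintro ⟨L, R⟩ ⟨L', R'⟩ ⟨h1, h2, h3⟩ ⟨h1', h2', h3'⟩
    refine ⟨fun a b => ?_, fun a b => ?_, fun a b => ?_⟩ <;> simp_all [add_mul, mul_add]
  algebraMap_mem' := by
    intro r
    refine ⟨fun a b => ?_, fun a b => ?_, fun a b => ?_⟩ <;>
      simp [Module.algebraMap_end_apply, smul_mul_assoc, mul_smul_comm]

/-- The multiplier algebra `M(A)`. -/
def MultiplierAlgebra : Type _ := ↥(multiplierSubalgebra A)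

instance : Ring (MultiplierAlgebra A) := inferInstanceAs (Ring ↥(multiplierSubalgebra A))

instance : Algebra ℂ (MultiplierAlgebra A) :=
  inferInstanceAs (Algebra ℂ ↥(multiplierSubalgebra A))

variable {A}

namespace MultiplierAlgebra

/-- The map `b ↦ m b`. -/
def left (m : MultiplierAlgebra A) : A →ₗ[ℂ] A := m.1.1

/-- The map `b ↦ b m`. -/
def right (m : MultiplierAlgebra A) : A →ₗ[ℂ] A := m.1.2.unop

/-- The multiplier with prescribed left and right actions. -/
def mk (L R : A →ₗ[ℂ] A) (hL : ∀ a b, L (a * b) = L a * b) (hR : ∀ a b, R (a * b) = a * R b)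
    (hLR : ∀ a b, R a * b = a * L b) : MultiplierAlgebra A :=
  ⟨(L, MulOpposite.op R), hL, hR, hLR⟩

theorem ext {m n : MultiplierAlgebra A} (hl : ∀ a, m.left a = n.left a)
    (hr : ∀ a, m.right a = n.right a) : m = n :=
  Subtype.ext (Prod.ext (LinearMap.ext hl) (MulOpposite.unop_injective (LinearMap.ext hr)))

theorem left_mul_apply (m : MultiplierAlgebra A) (a b : A) : m.left (a * b) = m.left a * b :=
  m.2.1 a b

theorem right_mul_apply (m : MultiplierAlgebra A) (a b : A) : m.right (a * b) = a * m.right b :=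
  m.2.2.1 a b

theorem right_mul_eq (m : MultiplierAlgebra A) (a b : A) : m.right a * b = a * m.left b :=
  m.2.2.2 a b

variable (A) in
/-- The canonical homomorphism `A → M(A)`, injective when the product is non-degenerate. -/
def incl : A →ₙₐ[ℂ] MultiplierAlgebra A where
  toFun a := mk (LinearMap.mulLeft ℂ a) (LinearMap.mulRight ℂ a)
    (fun x y => by simp [mul_assoc]) (fun x y => by simp [mul_assoc])
    (fun x y => by simp [mul_assoc])
  map_smul' r a := ext (fun x => smul_mul_assoc r a x) (fun x => mul_smul_comm r x a)
  map_zero' := ext (fun x => zero_mul x) (fun x => mul_zero x)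
  map_add' a b := ext (fun x => add_mul a b x) (fun x => mul_add x a b)
  map_mul' a b := ext (fun x => mul_assoc a b x) (fun x => (mul_assoc x a b).symm)

variable (A) in
/-- The canonical map `A → M(A)` as a linear map. -/
def inclₗ : A →ₗ[ℂ] MultiplierAlgebra A := (incl A : A →ₗ[ℂ] MultiplierAlgebra A)

/-- The subspace `A ⊆ M(A)`: the range of `A → M(A)`. -/
def inclRange (A : Type*) [NonUnitalRing A] [Module ℂ A] [IsScalarTower ℂ A A]
    [SMulCommClass ℂ A A] : Submodule ℂ (MultiplierAlgebra A) :=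
  LinearMap.range (inclₗ A)

variable {B : Type*} [NonUnitalRing B] [Module ℂ B] [IsScalarTower ℂ B B] [SMulCommClass ℂ B B]

/-- For algebra maps `i : B → A` and `π : A → B` with `π ∘ i = id`, the map `M(A) → M(B)` which
sends `(L, R)` to `(π ∘ L ∘ i, π ∘ R ∘ i)`. If `i` is an isomorphism with inverse `π`, this is the
extension of `π` to multipliers; if `B` is a direct factor of `A`, it is the projection of `M(A)`
on its factor `M(B)`. -/
def compress (i : B →ₗ[ℂ] A) (π : A →ₗ[ℂ] B) (hi : ∀ x y, i (x * y) = i x * i y)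
    (hπ : ∀ x y, π (x * y) = π x * π y) (hπi : ∀ x, π (i x) = x) :
    MultiplierAlgebra A →ₗ[ℂ] MultiplierAlgebra B where
  toFun m := mk (π ∘ₗ m.left ∘ₗ i) (π ∘ₗ m.right ∘ₗ i)
    (fun x y => by simp [hi, hπ, hπi, left_mul_apply])
    (fun x y => by simp [hi, hπ, hπi, right_mul_apply])
    (fun x y => by
      have h := congrArg π (right_mul_eq m (i x) (i y))
      simpa [hπ, hπi] using h)
  map_add' m n := ext (fun x => π.map_add _ _) (fun x => π.map_add _ _)
  map_smul' r m := ext (fun x => π.map_smul _ _) (fun x => π.map_smul _ _)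

/-- The isomorphism of multiplier algebras induced by an algebra isomorphism `e : A → B`. -/
def mapEquiv (e : A ≃ₗ[ℂ] B) (he : ∀ x y, e (x * y) = e x * e y) :
    MultiplierAlgebra A →ₙₐ[ℂ] MultiplierAlgebra B where
  __ := compress (e.symm : B →ₗ[ℂ] A) (e : A →ₗ[ℂ] B)
    (fun x y => e.injective (by simp [he])) he (fun x => by simp)
  map_zero' := map_zero (compress (e.symm : B →ₗ[ℂ] A) (e : A →ₗ[ℂ] B) _ _ _)
  map_mul' m n := by
    refine ext (fun x => ?_) (fun x => ?_)
    · change e (m.left (n.left (e.symm x))) = e (m.left (e.symm (e (n.left (e.symm x)))))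
      simp
    · change e (n.right (m.right (e.symm x))) = e (n.right (e.symm (e (m.right (e.symm x)))))
      simp

/-- The multiplier `m ⊗ n` of `A ⊗ B`. -/
def tmul : MultiplierAlgebra A →ₗ[ℂ] MultiplierAlgebra B →ₗ[ℂ] MultiplierAlgebra (A ⊗[ℂ] B) :=
  LinearMap.mk₂ ℂ
    (fun m n => mk (TensorProduct.map m.left n.left) (TensorProduct.map m.right n.right)
      (tensor_ext₂ (f := (LinearMap.mul ℂ (A ⊗[ℂ] B)).compr₂ (TensorProduct.map m.left n.left))
        (g := (LinearMap.mul ℂ (A ⊗[ℂ] B)) ∘ₗ (TensorProduct.map m.left n.left))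
        (fun a b a' b' => by simp [left_mul_apply]))
      (tensor_ext₂ (f := (LinearMap.mul ℂ (A ⊗[ℂ] B)).compr₂ (TensorProduct.map m.right n.right))
        (g := (LinearMap.mul ℂ (A ⊗[ℂ] B)).compl₂ (TensorProduct.map m.right n.right))
        (fun a b a' b' => by simp [right_mul_apply]))
      (tensor_ext₂ (f := (LinearMap.mul ℂ (A ⊗[ℂ] B)) ∘ₗ (TensorProduct.map m.right n.right))
        (g := (LinearMap.mul ℂ (A ⊗[ℂ] B)).compl₂ (TensorProduct.map m.left n.left))
        (fun a b a' b' => by simp [right_mul_eq])))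
    (fun m m' n => ext
      (fun x => LinearMap.congr_fun (TensorProduct.map_add_left m.left m'.left n.left) x)
      (fun x => LinearMap.congr_fun (TensorProduct.map_add_left m.right m'.right n.right) x))
    (fun c m n => ext
      (fun x => LinearMap.congr_fun (TensorProduct.map_smul_left c m.left n.left) x)
      (fun x => LinearMap.congr_fun (TensorProduct.map_smul_left c m.right n.right) x))
    (fun m n n' => ext
      (fun x => LinearMap.congr_fun (TensorProduct.map_add_right m.left n.left n'.left) x)
      (fun x => LinearMap.congr_fun (TensorProduct.map_add_right m.right n.right n'.right) x))
    (fun c m n => ext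
      (fun x => LinearMap.congr_fun (TensorProduct.map_smul_right c m.left n.left) x)
      (fun x => LinearMap.congr_fun (TensorProduct.map_smul_right c m.right n.right) x))

variable (B) in
/-- The multiplier `a ⊗ 1` of `A ⊗ B`. -/
def inl (a : A) : MultiplierAlgebra (A ⊗[ℂ] B) := tmul (incl A a) 1

variable (A) in
/-- The multiplier `1 ⊗ b` of `A ⊗ B`. -/
def inr (b : B) : MultiplierAlgebra (A ⊗[ℂ] B) := tmul 1 (incl B b)

/-- `ι ⊗ φ : A ⊗ B → A` for a linear functional `φ` on `B`. -/
def idTensor (φ : B →ₗ[ℂ] ℂ) : A ⊗[ℂ] B →ₗ[ℂ] A :=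
  (TensorProduct.rid ℂ A).toLinearMap ∘ₗ TensorProduct.map LinearMap.id φ

/-- `HasSlice φ m n`: the multiplier `(ι ⊗ φ)(m)` of `A` is defined and equal to `n`. That is, for
all `b` in `A`, the multipliers `m (b ⊗ 1)` and `(b ⊗ 1) m` belong to `A ⊗ B`, and
`n b = (ι ⊗ φ)(m (b ⊗ 1))`, `b n = (ι ⊗ φ)((b ⊗ 1) m)`. -/
def HasSlice (φ : B →ₗ[ℂ] ℂ) (m : MultiplierAlgebra (A ⊗[ℂ] B)) (n : MultiplierAlgebra A) : Prop :=
  ∀ b : A,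
    (∃ u : A ⊗[ℂ] B, incl (A ⊗[ℂ] B) u = m * inl B b ∧ n.left b = idTensor φ u) ∧
    (∃ u : A ⊗[ℂ] B, incl (A ⊗[ℂ] B) u = inl B b * m ∧ n.right b = idTensor φ u)

end MultiplierAlgebra

end MultiplierAlgebra

section MultiplierHopf

open MultiplierAlgebra

variable {A : Type*} [NonUnitalRing A] [Module ℂ A] [IsScalarTower ℂ A A] [SMulCommClass ℂ A A]

variable (A) in
theorem tensor_assoc_mul (x y : (A ⊗[ℂ] A) ⊗[ℂ] A) :
    TensorProduct.assoc ℂ A A A (x * y) =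
      TensorProduct.assoc ℂ A A A x * TensorProduct.assoc ℂ A A A y := by
  refine tensor_ext₂
    (f := (LinearMap.mul ℂ _).compr₂ (TensorProduct.assoc ℂ A A A).toLinearMap)
    (g := (LinearMap.mul ℂ _).compl₁₂ (TensorProduct.assoc ℂ A A A).toLinearMap
      (TensorProduct.assoc ℂ A A A).toLinearMap) (fun a b a' b' => ?_) x y
  have key := tensor_ext₂
    (f := (LinearMap.mul ℂ (A ⊗[ℂ] A)).compr₂
      ((TensorProduct.assoc ℂ A A A).toLinearMap ∘ₗ (TensorProduct.mk ℂ (A ⊗[ℂ] A) A).flip (b * b')))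
    (g := (LinearMap.mul ℂ _).compl₁₂
      ((TensorProduct.assoc ℂ A A A).toLinearMap ∘ₗ (TensorProduct.mk ℂ (A ⊗[ℂ] A) A).flip b)
      ((TensorProduct.assoc ℂ A A A).toLinearMap ∘ₗ (TensorProduct.mk ℂ (A ⊗[ℂ] A) A).flip b'))
    (fun c d c' d' => by simp) a a'
  simpa using key

variable (A) in
theorem tensor_comm_mul (x y : A ⊗[ℂ] A) :
    TensorProduct.comm ℂ A A (x * y) = TensorProduct.comm ℂ A A x * TensorProduct.comm ℂ A A y :=
  tensor_ext₂ (f := (LinearMap.mul ℂ _).compr₂ (TensorProduct.comm ℂ A A).toLinearMap)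
    (g := (LinearMap.mul ℂ _).compl₁₂ (TensorProduct.comm ℂ A A).toLinearMap
      (TensorProduct.comm ℂ A A).toLinearMap) (fun a b a' b' => by simp) x y

variable (A) in
/-- The identification of `M((A ⊗ A) ⊗ A)` with `M(A ⊗ (A ⊗ A))`. -/
def assocMultiplier :
    MultiplierAlgebra ((A ⊗[ℂ] A) ⊗[ℂ] A) →ₙₐ[ℂ] MultiplierAlgebra (A ⊗[ℂ] (A ⊗[ℂ] A)) :=
  mapEquiv (A := (A ⊗[ℂ] A) ⊗[ℂ] A) (B := A ⊗[ℂ] (A ⊗[ℂ] A)) (TensorProduct.assoc ℂ A A A)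
    (tensor_assoc_mul A)

variable (A) in
/-- The extension of the flip `σ` of `A ⊗ A` to `M(A ⊗ A)`. -/
def flipMultiplier : MultiplierAlgebra (A ⊗[ℂ] A) →ₙₐ[ℂ] MultiplierAlgebra (A ⊗[ℂ] A) :=
  mapEquiv (A := A ⊗[ℂ] A) (B := A ⊗[ℂ] A) (TensorProduct.comm ℂ A A) (tensor_comm_mul A)

/-- `T₁ : a ⊗ b ↦ Δ(a)(1 ⊗ b)`, with values in `M(A ⊗ A)`. -/
def canonicalMap₁ (Δ : A →ₙₐ[ℂ] MultiplierAlgebra (A ⊗[ℂ] A)) :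
    A ⊗[ℂ] A →ₗ[ℂ] MultiplierAlgebra (A ⊗[ℂ] A) :=
  TensorProduct.lift ((LinearMap.mul ℂ (MultiplierAlgebra (A ⊗[ℂ] A))).compl₁₂
    (Δ : A →ₗ[ℂ] MultiplierAlgebra (A ⊗[ℂ] A)) (tmul 1 ∘ₗ (inclₗ A)))

/-- `T₂ : a ⊗ b ↦ (a ⊗ 1)Δ(b)`, with values in `M(A ⊗ A)`. -/
def canonicalMap₂ (Δ : A →ₙₐ[ℂ] MultiplierAlgebra (A ⊗[ℂ] A)) :
    A ⊗[ℂ] A →ₗ[ℂ] MultiplierAlgebra (A ⊗[ℂ] A) :=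
  TensorProduct.lift ((LinearMap.mul ℂ (MultiplierAlgebra (A ⊗[ℂ] A))).compl₁₂
    (tmul.flip 1 ∘ₗ (inclₗ A))
    (Δ : A →ₗ[ℂ] MultiplierAlgebra (A ⊗[ℂ] A)))

/-- `Δ ⊗ ι : A ⊗ A → M((A ⊗ A) ⊗ A)`. -/
def comulTensorId (Δ : A →ₙₐ[ℂ] MultiplierAlgebra (A ⊗[ℂ] A)) :
    A ⊗[ℂ] A →ₗ[ℂ] MultiplierAlgebra ((A ⊗[ℂ] A) ⊗[ℂ] A) :=
  TensorProduct.lift (tmul.compl₁₂ (Δ : A →ₗ[ℂ] MultiplierAlgebra (A ⊗[ℂ] A))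
    (inclₗ A))

/-- `ι ⊗ Δ : A ⊗ A → M(A ⊗ (A ⊗ A))`. -/
def idTensorComul (Δ : A →ₙₐ[ℂ] MultiplierAlgebra (A ⊗[ℂ] A)) :
    A ⊗[ℂ] A →ₗ[ℂ] MultiplierAlgebra (A ⊗[ℂ] (A ⊗[ℂ] A)) :=
  TensorProduct.lift (tmul.compl₁₂ (inclₗ A)
    (Δ : A →ₗ[ℂ] MultiplierAlgebra (A ⊗[ℂ] A)))

/-- `Δ` is a comultiplication: `Δ(a)(1 ⊗ b)` and `(a ⊗ 1)Δ(b)` belong to `A ⊗ A`, and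
`(a ⊗ 1 ⊗ 1)(Δ ⊗ ι)(Δ(b)(1 ⊗ c)) = (ι ⊗ Δ)((a ⊗ 1)Δ(b))(1 ⊗ 1 ⊗ c)`. -/
structure IsComultiplication (Δ : A →ₙₐ[ℂ] MultiplierAlgebra (A ⊗[ℂ] A)) : Prop where
  cover₁ : ∀ a b : A, Δ a * inr A b ∈ inclRange (A ⊗[ℂ] A)
  cover₂ : ∀ a b : A, inl A a * Δ b ∈ inclRange (A ⊗[ℂ] A)
  coassoc : ∀ (a b c : A) (u v : A ⊗[ℂ] A),
    incl (A ⊗[ℂ] A) u = Δ b * inr A c → incl (A ⊗[ℂ] A) v = inl A a * Δ b →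
    assocMultiplier A (tmul (inl A a) 1 * comulTensorId Δ u) =
      idTensorComul Δ v * tmul 1 (inr A c)

/-- `(A, Δ)` is a multiplier Hopf algebra. -/
structure IsMultiplierHopfAlgebra (Δ : A →ₙₐ[ℂ] MultiplierAlgebra (A ⊗[ℂ] A)) : Prop
    extends IsComultiplication Δ where
  nondegenerate : NondegenerateProduct A
  /-- `T₁` is a bijection of `A ⊗ A` onto `A ⊗ A ⊆ M(A ⊗ A)`. -/
  injective₁ : Function.Injective (canonicalMap₁ Δ)
  range₁ : LinearMap.range (canonicalMap₁ Δ) = inclRange (A ⊗[ℂ] A)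
  /-- `T₂` is a bijection of `A ⊗ A` onto `A ⊗ A ⊆ M(A ⊗ A)`. -/
  injective₂ : Function.Injective (canonicalMap₂ Δ)
  range₂ : LinearMap.range (canonicalMap₂ Δ) = inclRange (A ⊗[ℂ] A)

/-- The opposite comultiplication `σ Δ`. -/
def coopposite (Δ : A →ₙₐ[ℂ] MultiplierAlgebra (A ⊗[ℂ] A)) :
    A →ₙₐ[ℂ] MultiplierAlgebra (A ⊗[ℂ] A) :=
  (flipMultiplier A).comp Δ

/-- `(A, Δ)` is a regular multiplier Hopf algebra: `(A, Δ)` and `(A, σ Δ)` are multiplier Hopf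
algebras. -/
structure IsRegularMultiplierHopfAlgebra (Δ : A →ₙₐ[ℂ] MultiplierAlgebra (A ⊗[ℂ] A)) : Prop
    extends IsMultiplierHopfAlgebra Δ where
  coopposite : IsMultiplierHopfAlgebra (coopposite Δ)

/-- `φ` is a left integral: it is non-zero and `(ι ⊗ φ)Δ(a) = φ(a) 1` in `M(A)` for all `a`. -/
structure IsLeftIntegral (Δ : A →ₙₐ[ℂ] MultiplierAlgebra (A ⊗[ℂ] A)) (φ : A →ₗ[ℂ] ℂ) : Prop where
  ne_zero : φ ≠ 0
  invariant : ∀ a : A, HasSlice φ (Δ a) (φ a • (1 : MultiplierAlgebra A))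

/-- `φ` is faithful on `B`: `a = 0` if `φ(ab) = 0` for all `b`, or if `φ(ba) = 0` for all `b`. -/
def IsFaithfulFunctional {B : Type*} [NonUnitalRing B] [Module ℂ B] (φ : B →ₗ[ℂ] ℂ) : Prop :=
  (∀ a : B, (∀ b : B, φ (a * b) = 0) → a = 0) ∧ (∀ a : B, (∀ b : B, φ (b * a) = 0) → a = 0)

/-- The image of `S ⊗ T` in `A ⊗ A ⊆ M(A ⊗ A)`, for subalgebras `S` and `T` of `A`. -/
def subTensor (S T : NonUnitalSubalgebra ℂ A) : Submodule ℂ (MultiplierAlgebra (A ⊗[ℂ] A)) :=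
  Submodule.span ℂ {m | ∃ a ∈ S, ∃ b ∈ T, m = incl (A ⊗[ℂ] A) (a ⊗ₜ b)}

open scoped Classical in
/-- A `G`-cograding of `(A, Δ)`: a family `(A_p)` of non-trivial subalgebras such that `A` is their
direct sum, `A_p A_q = 0` for `p ≠ q`, `Δ(A_{pq})(1 ⊗ A_q) = A_p ⊗ A_q` and
`(A_p ⊗ 1)Δ(A_{pq}) = A_p ⊗ A_q`. As usual, a product of two subspaces is the span of all products
of their elements. -/
structure Cograding (G : Type*) [Group G] (Δ : A →ₙₐ[ℂ] MultiplierAlgebra (A ⊗[ℂ] A)) where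
  part : G → NonUnitalSubalgebra ℂ A
  part_ne_bot : ∀ p, part p ≠ ⊥
  isInternal : DirectSum.IsInternal part
  mul_eq_zero : ∀ p q, p ≠ q → ∀ a ∈ part p, ∀ b ∈ part q, a * b = 0
  comul_right : ∀ p q, Submodule.span ℂ
    {m | ∃ a ∈ part (p * q), ∃ b ∈ part q, m = Δ a * inr A b} = subTensor (part p) (part q)
  comul_left : ∀ p q, Submodule.span ℂ
    {m | ∃ a ∈ part p, ∃ b ∈ part (p * q), m = inl A a * Δ b} = subTensor (part p) (part q)

namespace Cograding

variable {G : Type*} [Group G] {Δ : A →ₙₐ[ℂ] MultiplierAlgebra (A ⊗[ℂ] A)} (𝒜 : Cograding G Δ)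

/-- The inclusion `A_p → A`. -/
def ι (p : G) : 𝒜.part p →ₗ[ℂ] A where
  toFun a := a
  map_add' _ _ := rfl
  map_smul' _ _ := rfl

theorem ι_apply (p : G) (a : 𝒜.part p) : 𝒜.ι p a = a := rfl

open scoped Classical in
/-- The identification of `A` with the direct sum of the `A_p`. -/
def sumEquiv : (DirectSum G fun p => 𝒜.part p) ≃ₗ[ℂ] A :=
  LinearEquiv.ofBijective (DirectSum.toModule ℂ G A 𝒜.ι) 𝒜.isInternal

/-- The projection `A → A_p`, which maps `a` to its component `a(p)`. -/
def proj (p : G) : A →ₗ[ℂ] 𝒜.part p :=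
  DirectSum.component ℂ G (fun p => 𝒜.part p) p ∘ₗ 𝒜.sumEquiv.symm.toLinearMap

theorem proj_self (p : G) (a : 𝒜.part p) : 𝒜.proj p (a : A) = a := by
  classical
  have h : 𝒜.sumEquiv.symm (a : A) = DirectSum.lof ℂ G (fun p => 𝒜.part p) p a := by
    rw [LinearEquiv.symm_apply_eq]
    exact (DirectSum.toModule_lof (φ := 𝒜.ι) ℂ p a).symm
  simp [proj, h, DirectSum.component.lof_self]

theorem proj_of_ne {p q : G} (h : q ≠ p) (a : 𝒜.part q) : 𝒜.proj p (a : A) = 0 := by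
  classical
  have h' : 𝒜.sumEquiv.symm (a : A) = DirectSum.lof ℂ G (fun p => 𝒜.part p) q a := by
    rw [LinearEquiv.symm_apply_eq]
    exact (DirectSum.toModule_lof (φ := 𝒜.ι) ℂ q a).symm
  simp [proj, h', DirectSum.component.of, h]

theorem induction_on {P : A → Prop} (a : A) (zero : P 0) (add : ∀ a b, P a → P b → P (a + b))
    (part : ∀ p (a : 𝒜.part p), P a) : P a := by
  classical
  obtain ⟨x, rfl⟩ := 𝒜.sumEquiv.surjective a
  induction x using DirectSum.induction_on with
  | zero => simpa using zero
  | of p x =>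
    have : 𝒜.sumEquiv (DirectSum.of (fun p => 𝒜.part p) p x) = x :=
      DirectSum.toModule_lof (φ := 𝒜.ι) ℂ p x
    rw [this]
    exact part p x
  | add x y hx hy => rw [map_add]; exact add _ _ hx hy

theorem proj_mul (p : G) (a b : A) : 𝒜.proj p (a * b) = 𝒜.proj p a * 𝒜.proj p b := by
  refine 𝒜.induction_on (P := fun a => 𝒜.proj p (a * b) = 𝒜.proj p a * 𝒜.proj p b) a
    (by simp) (fun a a' h h' => by rw [add_mul, map_add, map_add, add_mul, h, h']) fun q a => ?_
  refine 𝒜.induction_on (P := fun b => 𝒜.proj p (a * b) = 𝒜.proj p a * 𝒜.proj p b) b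
    (by simp) (fun b b' h h' => by rw [mul_add, map_add, map_add, mul_add, h, h']) fun r b => ?_
  by_cases hqr : q = r
  · subst hqr
    by_cases hq : q = p
    · subst hq
      have := 𝒜.proj_self q (a * b)
      rw [proj_self, proj_self, ← this]
      rfl
    · have := 𝒜.proj_of_ne hq (a * b)
      rw [𝒜.proj_of_ne hq a, zero_mul, ← this]
      rfl
  · rw [𝒜.mul_eq_zero q r hqr a a.2 b b.2, map_zero]
    by_cases hq : q = p
    · rw [𝒜.proj_of_ne (fun h => hqr (hq.trans h.symm)) b, mul_zero]
    · rw [𝒜.proj_of_ne hq a, zero_mul]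

/-- The component `M(A ⊗ A) → M(A_p ⊗ A_q)` of `M(A ⊗ A) = ∏ M(A_p ⊗ A_q)`. -/
def multiplierComponent (p q : G) :
    MultiplierAlgebra (A ⊗[ℂ] A) →ₗ[ℂ] MultiplierAlgebra (𝒜.part p ⊗[ℂ] 𝒜.part q) :=
  compress (TensorProduct.map (𝒜.ι p) (𝒜.ι q)) (TensorProduct.map (𝒜.proj p) (𝒜.proj q))
    (tensor_ext₂ (f := (LinearMap.mul ℂ _).compr₂ (TensorProduct.map (𝒜.ι p) (𝒜.ι q)))
      (g := (LinearMap.mul ℂ _).compl₁₂ (TensorProduct.map (𝒜.ι p) (𝒜.ι q))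
        (TensorProduct.map (𝒜.ι p) (𝒜.ι q))) (fun a b a' b' => by simp [ι_apply]))
    (tensor_ext₂ (f := (LinearMap.mul ℂ _).compr₂ (TensorProduct.map (𝒜.proj p) (𝒜.proj q)))
      (g := (LinearMap.mul ℂ _).compl₁₂ (TensorProduct.map (𝒜.proj p) (𝒜.proj q))
        (TensorProduct.map (𝒜.proj p) (𝒜.proj q))) (fun a b a' b' => by simp [proj_mul]))
    (fun x => by
      induction x with
      | zero => simp
      | add x y hx hy => rw [map_add, map_add, hx, hy]
      | tmul a b =>
        have ha := 𝒜.proj_self p a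
        have hb := 𝒜.proj_self q b
        simpa [ι_apply] using congrArg₂ (· ⊗ₜ[ℂ] ·) ha hb)

/-- The component `Δ_{p,q} : A_{pq} → M(A_p ⊗ A_q)` of the comultiplication. -/
def comul (p q : G) : 𝒜.part (p * q) →ₗ[ℂ] MultiplierAlgebra (𝒜.part p ⊗[ℂ] 𝒜.part q) :=
  𝒜.multiplierComponent p q ∘ₗ (Δ : A →ₗ[ℂ] MultiplierAlgebra (A ⊗[ℂ] A)) ∘ₗ 𝒜.ι (p * q)

/-- The component `φ_p` of a linear functional `φ`: its restriction to `A_p`. -/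
def functional (φ : A →ₗ[ℂ] ℂ) (p : G) : 𝒜.part p →ₗ[ℂ] ℂ := φ ∘ₗ 𝒜.ι p

end Cograding

end MultiplierHopf

end

/-! The first claim reduces to faithfulness of `φ` on all of `A`: since `A_r A_p = 0` for `r ≠ p`,
testing `a ∈ A_p` against `A` is the same as testing it against `A_p`.

For `φ`, put `N = {y | φ(by) = 0 for all b}`. As `A ⊗ A` is spanned by the `(c ⊗ 1)Δ(b)`, and `(c ⊗
1)Δ(b)Δ(y) = (c ⊗ 1)Δ(by)` has slice `φ(by)c`, every `y ∈ N` satisfies `(ι ⊗ φ)((1 ⊗ b)Δ(y)) = 0`.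
Hence `N` is stable under `y ↦ (ω ⊗ ι)((d ⊗ 1)Δ(y))`. Moreover the counit `ε` kills `N`: in Sweedler
notation `T₂⁻¹(c ⊗ y) = cS(y₁) ⊗ y₂`, coassociativity gives `cS(y₁)φ(by₂) = 0` for all `b`, and
multiplying the legs yields `ε(y)φ(c) = φ(cS(y₁)y₂) = 0`. Applying `ε` to the slices of `(d ⊗
1)Δ(y)` gives `ω(dy) = 0` for all `ω` and `d`, so `y = 0`. The other side is the same argument in
the opposite algebra with the same `Δ`. The antipode never appears: only `T₂⁻¹` is used. The
carriers are `exists_counit`, `eq_zero_of_functional_mul` and `IsLeftIntegral.isFaithfulFunctional`.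

The second claim is invariance of `φ` read in one component: for `a ∈ A_{pq}` and `b ∈ A_p`, both
`(b ⊗ 1)Δ(a)` and `Δ(a)(b ⊗ 1)` lie in `A_p ⊗ A_q`, where slicing by `φ` is slicing by `φ_q`. -/

/-! ### Slice maps on tensor products -/

section LinearAlgebra

variable {V W U : Type*} [AddCommGroup V] [Module ℂ V] [AddCommGroup W] [Module ℂ W]
  [AddCommGroup U] [Module ℂ U]

/-- `ι ⊗ f : V ⊗ W → V` for a linear functional `f` on `W`. -/
noncomputable def sliceRight (V : Type*) [AddCommGroup V] [Module ℂ V] (f : W →ₗ[ℂ] ℂ) :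
    V ⊗[ℂ] W →ₗ[ℂ] V :=
  (TensorProduct.rid ℂ V).toLinearMap ∘ₗ f.lTensor V

/-- `f ⊗ ι : V ⊗ W → W` for a linear functional `f` on `V`. -/
noncomputable def sliceLeft (W : Type*) [AddCommGroup W] [Module ℂ W] (f : V →ₗ[ℂ] ℂ) :
    V ⊗[ℂ] W →ₗ[ℂ] W :=
  (TensorProduct.lid ℂ W).toLinearMap ∘ₗ f.rTensor W

@[simp] theorem sliceRight_tmul (f : W →ₗ[ℂ] ℂ) (v : V) (w : W) :
    sliceRight V f (v ⊗ₜ w) = f w • v := by simp [sliceRight]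

@[simp] theorem sliceLeft_tmul (f : V →ₗ[ℂ] ℂ) (v : V) (w : W) :
    sliceLeft W f (v ⊗ₜ w) = f v • w := by simp [sliceLeft]

open scoped Classical in
-- In a basis of `V`, a tensor is determined by its coefficients in `W`, and these are its slices by
-- the coordinate functionals.
theorem eq_zero_of_sliceLeft {x : V ⊗[ℂ] W} (h : ∀ f : V →ₗ[ℂ] ℂ, sliceLeft W f x = 0) :
    x = 0 := by
  let b := Module.Free.chooseBasis ℂ V
  apply (TensorProduct.equivFinsuppOfBasisLeft (N := W) b).injective
  rw [map_zero]
  ext i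
  rw [Finsupp.zero_apply, ← h (b.coord i), TensorProduct.equivFinsuppOfBasisLeft_apply]
  rfl

theorem comp_sliceRight (g : V →ₗ[ℂ] U) (f : W →ₗ[ℂ] ℂ) (x : V ⊗[ℂ] W) :
    g (sliceRight V f x) = sliceRight U f (g.rTensor W x) := by
  induction x with
  | zero => simp
  | add x y hx hy => simp only [map_add, hx, hy]
  | tmul v w => simp

theorem sliceRight_lTensor (g : U →ₗ[ℂ] W) (f : W →ₗ[ℂ] ℂ) (x : V ⊗[ℂ] U) :
    sliceRight V f (g.lTensor V x) = sliceRight V (f ∘ₗ g) x := by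
  rw [sliceRight, sliceRight, LinearMap.lTensor_comp]
  rfl

theorem sliceLeft_rTensor (g : U →ₗ[ℂ] V) (f : V →ₗ[ℂ] ℂ) (x : U ⊗[ℂ] W) :
    sliceLeft W f (g.rTensor W x) = sliceLeft W (f ∘ₗ g) x := by
  rw [sliceLeft, sliceLeft, LinearMap.rTensor_comp]
  rfl

theorem comp_sliceLeft (g : W →ₗ[ℂ] U) (f : V →ₗ[ℂ] ℂ) (x : V ⊗[ℂ] W) :
    g (sliceLeft W f x) = sliceLeft U f (g.lTensor V x) := by
  induction x with
  | zero => simp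
  | add x y hx hy => simp only [map_add, hx, hy]
  | tmul v w => simp

theorem sliceLeft_sliceRight (f : V →ₗ[ℂ] ℂ) (g : W →ₗ[ℂ] ℂ) (x : V ⊗[ℂ] W) :
    g (sliceLeft W f x) = f (sliceRight V g x) := by
  induction x with
  | zero => simp
  | add x y hx hy => simp only [map_add, hx, hy]
  | tmul v w => simp [mul_comm]

theorem sliceRight_assoc_symm (f : U →ₗ[ℂ] ℂ) (x : V ⊗[ℂ] (W ⊗[ℂ] U)) :
    sliceRight (V ⊗[ℂ] W) f ((TensorProduct.assoc ℂ V W U).symm x) =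
      (sliceRight W f).lTensor V x := by
  have : sliceRight (V ⊗[ℂ] W) f ∘ₗ (TensorProduct.assoc ℂ V W U).symm.toLinearMap =
      (sliceRight W f).lTensor V := by
    ext v w u
    simp
  exact LinearMap.congr_fun this x

theorem lTensor_assoc_symm {U' : Type*} [AddCommGroup U'] [Module ℂ U'] (f : U →ₗ[ℂ] U')
    (x : V ⊗[ℂ] (W ⊗[ℂ] U)) :
    f.lTensor (V ⊗[ℂ] W) ((TensorProduct.assoc ℂ V W U).symm x) =
      (TensorProduct.assoc ℂ V W U').symm ((f.lTensor W).lTensor V x) := by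
  have : f.lTensor (V ⊗[ℂ] W) ∘ₗ (TensorProduct.assoc ℂ V W U).symm.toLinearMap =
      (TensorProduct.assoc ℂ V W U').symm.toLinearMap ∘ₗ (f.lTensor W).lTensor V := by
    ext v w u
    simp
  exact LinearMap.congr_fun this x

/-- A jointly injective family of linear maps stays jointly injective after tensoring on the
left. -/
theorem eq_zero_of_lTensor {ι : Type*} {f : ι → W →ₗ[ℂ] U} (hf : ∀ w, (∀ i, f i w = 0) → w = 0)
    {x : V ⊗[ℂ] W} (h : ∀ i, (f i).lTensor V x = 0) : x = 0 :=
  eq_zero_of_sliceLeft fun g => hf _ fun i => by rw [comp_sliceLeft, h, map_zero]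

theorem eq_zero_of_rTensor {ι : Type*} {f : ι → W →ₗ[ℂ] U} (hf : ∀ w, (∀ i, f i w = 0) → w = 0)
    {x : W ⊗[ℂ] V} (h : ∀ i, (f i).rTensor V x = 0) : x = 0 := by
  apply (TensorProduct.comm ℂ W V).injective
  rw [map_zero]
  refine eq_zero_of_lTensor hf fun i => ?_
  rw [LinearMap.lTensor_comm, h, map_zero]

end LinearAlgebra

/-! ### The counit, and faithfulness from absorption, for abstract canonical maps -/

section Counit

variable {A : Type*} [AddCommGroup A] [Module ℂ A]

/-- The counit attached to maps `T₁ (y ⊗ b) = Δ(y)(1 ⊗ b)` and `T₂ (c ⊗ y) = (c ⊗ 1)Δ(y)`. -/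
theorem exists_counit (m : A →ₗ[ℂ] A →ₗ[ℂ] A) (T₁ : A ⊗[ℂ] A →ₗ[ℂ] A ⊗[ℂ] A)
    (T₂ : A ⊗[ℂ] A ≃ₗ[ℂ] A ⊗[ℂ] A) (hT₁ : Function.Surjective T₁)
    (coassoc : ∀ c y b : A,
      T₂.toLinearMap.rTensor A ((TensorProduct.assoc ℂ A A A).symm (c ⊗ₜ T₁ (y ⊗ₜ b))) =
        (TensorProduct.assoc ℂ A A A).symm
          (T₁.lTensor A (TensorProduct.assoc ℂ A A A (T₂ (c ⊗ₜ y) ⊗ₜ b))))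
    (cover : ∀ c y b : A,
      (m c).rTensor A (T₁ (y ⊗ₜ b)) = (m.flip b).lTensor A (T₂ (c ⊗ₜ y))) :
    ∃ ε : A →ₗ[ℂ] ℂ, (∀ x, sliceRight A ε (T₂ x) = TensorProduct.lift m x) ∧
      ∀ x, sliceLeft A ε (T₁ x) = TensorProduct.lift m x := by
  -- This is `(T₂ ⊗ ι)(ι ⊗ T₁) = (ι ⊗ T₁)(T₂ ⊗ ι)` on `A ⊗ A ⊗ A`.
  have coassoc' : ∀ (x : A ⊗[ℂ] A) (b : A),
      T₂.toLinearMap.rTensor A ((TensorProduct.assoc ℂ A A A).symm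
        (T₁.lTensor A (TensorProduct.assoc ℂ A A A (x ⊗ₜ b)))) =
        (TensorProduct.assoc ℂ A A A).symm
          (T₁.lTensor A (TensorProduct.assoc ℂ A A A (T₂ x ⊗ₜ b))) := by
    intro x b
    induction x with
    | zero => simp
    | add x y hx hy => simp only [TensorProduct.add_tmul, map_add, hx, hy]
    | tmul c y => rw [← coassoc]; simp
  have cover' : ∀ (x : A ⊗[ℂ] A) (b : A),
      (TensorProduct.lift m).rTensor A ((TensorProduct.assoc ℂ A A A).symm
        (T₁.lTensor A (TensorProduct.assoc ℂ A A A (x ⊗ₜ b)))) =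
        (m.flip b).lTensor A (T₂ x) := by
    intro x b
    induction x with
    | zero => simp
    | add x y hx hy => simp only [TensorProduct.add_tmul, map_add, hx, hy]
    | tmul c y =>
      rw [← cover]
      simp only [TensorProduct.assoc_tmul, LinearMap.lTensor_tmul]
      generalize T₁ (y ⊗ₜ b) = z
      induction z with
      | zero => simp
      | add x y hx hy => simp only [TensorProduct.tmul_add, map_add, hx, hy]
      | tmul p q => simp
  -- Heuristically `F c y = cS(y₁)y₂`, so it must turn out to be `ε(y)c`.
  let F : A →ₗ[ℂ] A →ₗ[ℂ] A :=
    (TensorProduct.mk ℂ A A).compr₂ (TensorProduct.lift m ∘ₗ T₂.symm.toLinearMap)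
  have key : ∀ (c : A) (z : A ⊗[ℂ] A),
      (F c).rTensor A (T₁ z) = c ⊗ₜ TensorProduct.lift m z := by
    intro c z
    induction z with
    | zero => simp
    | add x y hx hy => simp only [TensorProduct.tmul_add, map_add, hx, hy]
    | tmul y b =>
      -- With `T₂⁻¹(c ⊗ y)` in the first two legs, `cover'` evaluates to `c ⊗ yb`, while
      -- coassociativity moves `T₂⁻¹` past `T₁` and produces `F c`.
      have h := coassoc' (T₂.symm (c ⊗ₜ y)) b
      have h2 := cover' (T₂.symm (c ⊗ₜ y)) b
      rw [T₂.apply_symm_apply] at h h2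
      have h3 := congrArg (T₂.symm.toLinearMap.rTensor A) h
      rw [← LinearMap.rTensor_comp_apply] at h3
      simp only [LinearEquiv.comp_coe, LinearEquiv.self_trans_symm, LinearEquiv.refl_toLinearMap,
        LinearMap.rTensor_id, LinearMap.id_apply] at h3
      rw [h3] at h2
      simp only [LinearMap.lTensor_tmul, TensorProduct.assoc_tmul, LinearMap.flip_apply] at h2
      rw [TensorProduct.lift.tmul, ← h2, ← LinearMap.rTensor_comp_apply]
      generalize T₁ (y ⊗ₜ b) = z
      induction z with
      | zero => simp
      | add x y hx hy => simp only [TensorProduct.tmul_add, map_add, hx, hy]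
      | tmul p q => simp [F]
  rcases subsingleton_or_nontrivial A with hA | hA
  · exact ⟨0, fun x => Subsingleton.elim _ _, fun x => Subsingleton.elim _ _⟩
  obtain ⟨e, he⟩ := exists_ne (0 : A)
  obtain ⟨γ, hγ⟩ : ∃ γ : A →ₗ[ℂ] ℂ, γ e = 1 := by
    obtain ⟨g, hg⟩ := not_forall.1 (mt (Module.forall_dual_apply_eq_zero_iff ℂ e).1 he)
    exact ⟨(g e)⁻¹ • g, by simp [hg]⟩
  -- Writing `y ⊗ e = T₁ z`, `key` reads `F c y ⊗ e = c ⊗ m(z)`. Slicing by `γ` leaves a coefficient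
  -- of `c` that does not depend on `c`; taking `c = e` identifies it.
  have scalar : ∀ c y, F c y = γ (F e y) • c := by
    intro c y
    obtain ⟨z, hz⟩ := hT₁ (y ⊗ₜ e)
    have h : ∀ c, F c y = γ (TensorProduct.lift m z) • c := by
      intro c
      have := congrArg (sliceRight A γ) (key c z)
      rw [hz] at this
      simpa [hγ] using this
    rw [h e, map_smul, hγ, h c, smul_eq_mul, mul_one]
  refine ⟨γ ∘ₗ F e, fun x => ?_, fun x => ?_⟩
  · obtain ⟨w, rfl⟩ := T₂.symm.surjective x
    rw [T₂.apply_symm_apply]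
    induction w with
    | zero => simp
    | add x y hx hy => simp only [map_add, hx, hy]
    | tmul c y => exact (sliceRight_tmul _ _ _).trans (scalar c y).symm
  · rw [← sliceLeft_rTensor, key, sliceLeft_tmul, hγ, one_smul]

/-- A functional `φ` which satisfies the absorption property `invariant` is faithful on one side.
Here `T₁ (y ⊗ b) = Δ(y)(1 ⊗ b)`, `T₂ (c ⊗ y) = (c ⊗ 1)Δ(y)` and `D b y = (1 ⊗ b)Δ(y)`. -/
theorem eq_zero_of_functional_mul (m : A →ₗ[ℂ] A →ₗ[ℂ] A)
    (m_assoc : ∀ a b c, m (m a b) c = m a (m b c))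
    (nondeg_left : ∀ a, (∀ b, m a b = 0) → a = 0) (nondeg_right : ∀ a, (∀ b, m b a = 0) → a = 0)
    (T₁ : A ⊗[ℂ] A →ₗ[ℂ] A ⊗[ℂ] A)
    (T₂ : A ⊗[ℂ] A ≃ₗ[ℂ] A ⊗[ℂ] A) (hT₁ : Function.Surjective T₁)
    (coassoc : ∀ c y b : A,
      T₂.toLinearMap.rTensor A ((TensorProduct.assoc ℂ A A A).symm (c ⊗ₜ T₁ (y ⊗ₜ b))) =
        (TensorProduct.assoc ℂ A A A).symm
          (T₁.lTensor A (TensorProduct.assoc ℂ A A A (T₂ (c ⊗ₜ y) ⊗ₜ b))))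
    (cover : ∀ c y b : A,
      (m c).rTensor A (T₁ (y ⊗ₜ b)) = (m.flip b).lTensor A (T₂ (c ⊗ₜ y)))
    (D : A → A →ₗ[ℂ] A ⊗[ℂ] A)
    (cover_right : ∀ b y c, (m.flip c).lTensor A (D b y) = (m b).lTensor A (T₁ (y ⊗ₜ c)))
    (cover_left : ∀ b y d, (m d).rTensor A (D b y) = (m b).lTensor A (T₂ (d ⊗ₜ y)))
    (φ : A →ₗ[ℂ] ℂ) (hφ : φ ≠ 0)
    (invariant : ∀ y, (∀ b, φ (m b y) = 0) → ∀ b, sliceRight A φ (D b y) = 0)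
    (y : A) (hy : ∀ b, φ (m b y) = 0) : y = 0 := by
  obtain ⟨ε, hε₂, hε₁⟩ := exists_counit m T₁ T₂ hT₁ coassoc cover
  -- `D` is known only after covering, so the identity is checked after multiplying by an arbitrary
  -- `c` on the right, which turns `D` into `T₁`.
  have counit_D : ∀ b y, sliceLeft A ε (D b y) = m b y := by
    intro b y
    refine sub_eq_zero.1 (nondeg_left _ fun c => ?_)
    rw [map_sub, LinearMap.sub_apply, sub_eq_zero, ← LinearMap.flip_apply m, comp_sliceLeft,
      cover_right, ← comp_sliceLeft, hε₁, TensorProduct.lift.tmul, m_assoc]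
  have coassoc_D : ∀ (b : A) (x : A ⊗[ℂ] A),
      T₂.toLinearMap.rTensor A ((TensorProduct.assoc ℂ A A A).symm ((D b).lTensor A x)) =
        (TensorProduct.assoc ℂ A A A).symm ((D b).lTensor A (T₂ x)) := by
    intro b x
    induction x with
    | zero => simp
    | add x y hx hy => simp only [map_add, hx, hy]
    | tmul c y =>
      -- Multiplying the last leg by `e` on the right replaces `D b` by `T₁` followed by
      -- multiplication by `b`, and the latter commutes with `T₂ ⊗ ι`.
      refine sub_eq_zero.1 (eq_zero_of_lTensor (f := fun e => m.flip e) nondeg_left fun e => ?_)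
      rw [map_sub, sub_eq_zero]
      have h : ∀ v : A ⊗[ℂ] A,
          (m.flip e).lTensor (A ⊗[ℂ] A)
            ((TensorProduct.assoc ℂ A A A).symm ((D b).lTensor A v)) =
          (m b).lTensor (A ⊗[ℂ] A) ((TensorProduct.assoc ℂ A A A).symm
            (T₁.lTensor A (TensorProduct.assoc ℂ A A A (v ⊗ₜ e)))) := by
        intro v
        induction v with
        | zero => simp
        | add x y hx hy => simp only [TensorProduct.add_tmul, map_add, hx, hy]
        | tmul p q =>
          rw [lTensor_assoc_symm, lTensor_assoc_symm]
          simp only [LinearMap.lTensor_tmul, TensorProduct.assoc_tmul, cover_right]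
      have swap : ∀ (f : A →ₗ[ℂ] A) (z : (A ⊗[ℂ] A) ⊗[ℂ] A),
          f.lTensor (A ⊗[ℂ] A) (T₂.toLinearMap.rTensor A z) =
            T₂.toLinearMap.rTensor A (f.lTensor (A ⊗[ℂ] A) z) := by
        intro f z
        rw [← LinearMap.comp_apply, ← LinearMap.comp_apply, LinearMap.lTensor_comp_rTensor,
          LinearMap.rTensor_comp_lTensor]
      rw [h, ← coassoc, swap, swap, h]
      simp only [LinearMap.lTensor_tmul, TensorProduct.assoc_tmul]
  -- Slicing the last leg of `coassoc_D` by `φ` gives `0` by `invariant`. Injectivity of `T₂`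
  -- removes `T₂`, and applying `ε` to the second leg leaves `φ(b ·)`, by `counit_D`.
  have slice_inv : ∀ y, (∀ b, φ (m b y) = 0) → ∀ c b,
      sliceRight A (φ ∘ₗ m b) (T₂.symm (c ⊗ₜ y)) = 0 := by
    intro y hy c b
    have h := congrArg (sliceRight (A ⊗[ℂ] A) φ) (coassoc_D b (T₂.symm (c ⊗ₜ y)))
    rw [← comp_sliceRight, sliceRight_assoc_symm, sliceRight_assoc_symm, T₂.apply_symm_apply,
      LinearMap.lTensor_tmul, LinearMap.lTensor_tmul, invariant y hy, TensorProduct.tmul_zero,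
      LinearEquiv.coe_coe, LinearEquiv.map_eq_zero_iff, ← LinearMap.lTensor_comp_apply] at h
    have h' := congrArg (sliceRight A ε) h
    rw [sliceRight_lTensor, map_zero] at h'
    convert h' using 2
    congr 1
    ext z
    simp only [LinearMap.comp_apply]
    rw [← sliceLeft_sliceRight, counit_D]
  have hε : ∀ y, (∀ b, φ (m b y) = 0) → ε y = 0 := by
    intro y hy
    obtain ⟨c, hc⟩ : ∃ c, φ c ≠ 0 := by
      by_contra! h
      exact hφ (LinearMap.ext h)
    have h := hε₂ (T₂.symm (c ⊗ₜ y))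
    rw [T₂.apply_symm_apply, sliceRight_tmul] at h
    -- `K z` is the functional `φ(· z)`. Since `φ(pq)` depends on `q` only through `K q`, vanishing
    -- of all slices by `φ(b ·)` forces `φ` of the product of the legs to vanish.
    let K : A →ₗ[ℂ] A →ₗ[ℂ] ℂ := (m.compr₂ φ).flip
    have hK : K.lTensor A (T₂.symm (c ⊗ₜ y)) = 0 := by
      refine eq_zero_of_lTensor (f := fun b : A => LinearMap.applyₗ b)
        (fun g hg => LinearMap.ext hg) fun b => ?_
      apply (TensorProduct.rid ℂ A).injective
      rw [map_zero, ← slice_inv y hy c b, ← LinearMap.lTensor_comp_apply]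
      rfl
    have hm : ∀ x, φ (TensorProduct.lift m x) =
        TensorProduct.lift LinearMap.applyₗ (K.lTensor A x) := by
      intro x
      induction x with
      | zero => simp
      | add x y hx hy => simp only [map_add, hx, hy]
      | tmul p q => simp [K]
    have h' := hm (T₂.symm (c ⊗ₜ y))
    rw [hK, map_zero, ← h, map_smul, smul_eq_mul, mul_eq_zero] at h'
    exact h'.resolve_right hc
  -- Here `ω(dy) = ε((ω ⊗ ι)T₂(d ⊗ y))`, so it suffices that this slice satisfies the hypothesis of
  -- `hε`. Multiplying it by `b` and applying `φ` gives `ω(d · (ι ⊗ φ)(D b y)) = 0`.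
  refine nondeg_right y fun d => ?_
  rw [← TensorProduct.lift.tmul, ← hε₂, ← Module.forall_dual_apply_eq_zero_iff ℂ]
  intro ω
  rw [← sliceLeft_sliceRight]
  refine hε _ fun b => ?_
  rw [comp_sliceLeft, sliceLeft_sliceRight, ← cover_left, ← comp_sliceRight, invariant y hy,
    map_zero, map_zero]

end Counit

/-! ### Calculus of multipliers on tensor products -/

section MultiplierLemmas

open MultiplierAlgebra

variable {A B : Type*} [NonUnitalRing A] [Module ℂ A] [IsScalarTower ℂ A A] [SMulCommClass ℂ A A]
  [NonUnitalRing B] [Module ℂ B] [IsScalarTower ℂ B B] [SMulCommClass ℂ B B]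

namespace MultiplierAlgebra

@[simp] theorem left_mul (m n : MultiplierAlgebra A) (a : A) :
    (m * n).left a = m.left (n.left a) := rfl

@[simp] theorem right_mul (m n : MultiplierAlgebra A) (a : A) :
    (m * n).right a = n.right (m.right a) := rfl

@[simp] theorem left_incl (a b : A) : (incl A a).left b = a * b := rfl

@[simp] theorem right_incl (a b : A) : (incl A a).right b = b * a := rfl

theorem left_tmul (m : MultiplierAlgebra A) (n : MultiplierAlgebra B) :
    (tmul m n).left = TensorProduct.map m.left n.left := rfl

theorem right_tmul (m : MultiplierAlgebra A) (n : MultiplierAlgebra B) :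
    (tmul m n).right = TensorProduct.map m.right n.right := rfl

theorem left_inl (a : A) : (inl B a).left = (LinearMap.mulLeft ℂ a).rTensor B := rfl

theorem right_inl (a : A) : (inl B a).right = (LinearMap.mulRight ℂ a).rTensor B := rfl

theorem tmul_mul_tmul (m m' : MultiplierAlgebra A) (n n' : MultiplierAlgebra B) :
    tmul m n * tmul m' n' = tmul (m * m') (n * n') := by
  refine ext (fun x => ?_) (fun x => ?_)
  · induction x with
    | zero => simp
    | add x y hx hy => rw [map_add, map_add, hx, hy]
    | tmul a b => simp [left_tmul]
  · induction x with
    | zero => simp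
    | add x y hx hy => rw [map_add, map_add, hx, hy]
    | tmul a b => simp [right_tmul]

/-- With `mul_incl`, this says that `A` is a two-sided ideal of `M(A)`. It is how identities between
multipliers are brought back to `A ⊗ A`. -/
theorem incl_mul (m : MultiplierAlgebra A) (a : A) : incl A a * m = incl A (m.right a) :=
  ext (fun x => (right_mul_eq m a x).symm) (fun x => right_mul_apply m x a)

theorem mul_incl (m : MultiplierAlgebra A) (a : A) : m * incl A a = incl A (m.left a) :=
  ext (fun x => left_mul_apply m a x) (fun x => right_mul_eq m x a)

theorem tmul_incl_incl (a : A) (b : B) : tmul (incl A a) (incl B b) = incl (A ⊗[ℂ] B) (a ⊗ₜ b) := by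
  refine ext (fun x => ?_) (fun x => ?_)
  · induction x with
    | zero => simp
    | add x y hx hy => rw [map_add, map_add, hx, hy]
    | tmul a b => simp [left_tmul]
  · induction x with
    | zero => simp
    | add x y hx hy => rw [map_add, map_add, hx, hy]
    | tmul a b => simp [right_tmul]

theorem inl_mul_incl (a : A) (x : A ⊗[ℂ] B) :
    inl B a * incl (A ⊗[ℂ] B) x = incl (A ⊗[ℂ] B) ((LinearMap.mulLeft ℂ a).rTensor B x) :=
  mul_incl _ _

theorem incl_mul_inl (a : A) (x : A ⊗[ℂ] B) :
    incl (A ⊗[ℂ] B) x * inl B a = incl (A ⊗[ℂ] B) ((LinearMap.mulRight ℂ a).rTensor B x) :=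
  incl_mul _ _

theorem inr_mul_incl (b : B) (x : A ⊗[ℂ] B) :
    inr A b * incl (A ⊗[ℂ] B) x = incl (A ⊗[ℂ] B) ((LinearMap.mulLeft ℂ b).lTensor A x) :=
  mul_incl _ _

theorem incl_mul_inr (b : B) (x : A ⊗[ℂ] B) :
    incl (A ⊗[ℂ] B) x * inr A b = incl (A ⊗[ℂ] B) ((LinearMap.mulRight ℂ b).lTensor A x) :=
  incl_mul _ _

theorem inl_mul_inr (a : A) (b : B) : inl B a * inr A b = incl (A ⊗[ℂ] B) (a ⊗ₜ b) := by
  rw [inl, inr, tmul_mul_tmul, one_mul, mul_one, tmul_incl_incl]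

theorem inr_mul_inl (a : A) (b : B) : inr A b * inl B a = incl (A ⊗[ℂ] B) (a ⊗ₜ b) := by
  rw [inl, inr, tmul_mul_tmul, one_mul, mul_one, tmul_incl_incl]

theorem incl_injective (h : NondegenerateProduct A) : Function.Injective (incl A) := by
  intro a b hab
  refine sub_eq_zero.1 (h.1 _ fun c => ?_)
  have := congrArg (fun m => m.left c) hab
  simpa [sub_mul, sub_eq_zero] using this

theorem mapEquiv_incl (e : A ≃ₗ[ℂ] B) (he : ∀ x y, e (x * y) = e x * e y) (a : A) :
    mapEquiv e he (incl A a) = incl B (e a) := by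
  refine ext (fun x => ?_) (fun x => ?_)
  · change e (a * e.symm x) = e a * x
    rw [he, e.apply_symm_apply]
  · change e (e.symm x * a) = x * e a
    rw [he, e.apply_symm_apply]

end MultiplierAlgebra

theorem mul_tmul_eq (x : A ⊗[ℂ] B) (a : A) (b : B) :
    x * (a ⊗ₜ b) = (LinearMap.mulRight ℂ a).rTensor B ((LinearMap.mulRight ℂ b).lTensor A x) := by
  induction x with
  | zero => simp
  | add x y hx hy => rw [add_mul, hx, hy, map_add, map_add]
  | tmul p q => simp

theorem tmul_mul_eq (x : A ⊗[ℂ] B) (a : A) (b : B) :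
    (a ⊗ₜ b) * x = (LinearMap.mulLeft ℂ a).rTensor B ((LinearMap.mulLeft ℂ b).lTensor A x) := by
  induction x with
  | zero => simp
  | add x y hx hy => rw [mul_add, hx, hy, map_add, map_add]
  | tmul p q => simp

/-- Multiplication by `a ⊗ b` acts one leg at a time, and a jointly injective family on one leg
stays jointly injective on the tensor product. -/
theorem NondegenerateProduct.tensor (hA : NondegenerateProduct A) (hB : NondegenerateProduct B) :
    NondegenerateProduct (A ⊗[ℂ] B) := by
  constructor
  · intro x h
    refine eq_zero_of_lTensor (f := fun b : B => LinearMap.mulRight ℂ b) hB.1 fun b => ?_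
    refine eq_zero_of_rTensor (f := fun a : A => LinearMap.mulRight ℂ a) hA.1 fun a => ?_
    rw [← mul_tmul_eq, h]
  · intro x h
    refine eq_zero_of_lTensor (f := fun b : B => LinearMap.mulLeft ℂ b) hB.2 fun b => ?_
    refine eq_zero_of_rTensor (f := fun a : A => LinearMap.mulLeft ℂ a) hA.2 fun a => ?_
    rw [← tmul_mul_eq, h]

end MultiplierLemmas

/-! ### Canonical maps and faithfulness of left integrals -/

section MultiplierHopfMaps

open MultiplierAlgebra

/-- Used to turn the canonical maps, valued in `M(A ⊗ A)`, into bijections of `A ⊗ A`. -/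
theorem LinearMap.exists_equiv_of_range_eq {X Y Z : Type*} [AddCommGroup X] [Module ℂ X]
    [AddCommGroup Y] [Module ℂ Y] [AddCommGroup Z] [Module ℂ Z] {f : X →ₗ[ℂ] Z} {g : Y →ₗ[ℂ] Z}
    (hf : Function.Injective f) (hg : Function.Injective g)
    (h : LinearMap.range f = LinearMap.range g) : ∃ e : X ≃ₗ[ℂ] Y, ∀ x, g (e x) = f x := by
  refine ⟨(LinearEquiv.ofInjective f hf).trans
    ((LinearEquiv.ofEq _ _ h).trans (LinearEquiv.ofInjective g hg).symm), fun x => ?_⟩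
  have := LinearEquiv.apply_symm_apply (LinearEquiv.ofInjective g hg)
    (LinearEquiv.ofEq _ _ h (LinearEquiv.ofInjective f hf x))
  exact congrArg Subtype.val this

variable {A : Type*} [NonUnitalRing A] [Module ℂ A] [IsScalarTower ℂ A A] [SMulCommClass ℂ A A]
  {Δ : A →ₙₐ[ℂ] MultiplierAlgebra (A ⊗[ℂ] A)}

theorem IsMultiplierHopfAlgebra.incl_injective (hΔ : IsMultiplierHopfAlgebra Δ) :
    Function.Injective (incl (A ⊗[ℂ] A)) :=
  MultiplierAlgebra.incl_injective (hΔ.nondegenerate.tensor hΔ.nondegenerate)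

/-- The canonical maps as bijections of `A ⊗ A`. -/
theorem IsMultiplierHopfAlgebra.exists_canonical (hΔ : IsMultiplierHopfAlgebra Δ) :
    ∃ T₁ T₂ : A ⊗[ℂ] A ≃ₗ[ℂ] A ⊗[ℂ] A,
      (∀ a b, incl (A ⊗[ℂ] A) (T₁ (a ⊗ₜ b)) = Δ a * inr A b) ∧
      (∀ a b, incl (A ⊗[ℂ] A) (T₂ (a ⊗ₜ b)) = inl A a * Δ b) ∧
      ∀ c y b : A,
        T₂.toLinearMap.rTensor A ((TensorProduct.assoc ℂ A A A).symm (c ⊗ₜ T₁ (y ⊗ₜ b))) =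
          (TensorProduct.assoc ℂ A A A).symm
            (T₁.toLinearMap.lTensor A (TensorProduct.assoc ℂ A A A (T₂ (c ⊗ₜ y) ⊗ₜ b))) := by
  have hinj : Function.Injective (inclₗ (A ⊗[ℂ] A)) := hΔ.incl_injective
  obtain ⟨T₁, h₁⟩ := LinearMap.exists_equiv_of_range_eq hΔ.injective₁ hinj hΔ.range₁
  obtain ⟨T₂, h₂⟩ := LinearMap.exists_equiv_of_range_eq hΔ.injective₂ hinj hΔ.range₂
  have h₁' : ∀ a b, incl (A ⊗[ℂ] A) (T₁ (a ⊗ₜ b)) = Δ a * inr A b := fun a b => h₁ (a ⊗ₜ b)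
  have h₂' : ∀ a b, incl (A ⊗[ℂ] A) (T₂ (a ⊗ₜ b)) = inl A a * Δ b := fun a b => h₂ (a ⊗ₜ b)
  refine ⟨T₁, T₂, h₁', h₂', fun c y b => ?_⟩
  apply (TensorProduct.assoc ℂ A A A).injective
  rw [LinearEquiv.apply_symm_apply]
  apply MultiplierAlgebra.incl_injective
    (hΔ.nondegenerate.tensor (hΔ.nondegenerate.tensor hΔ.nondegenerate))
  -- Both sides of the coassociativity axiom are images of elements of the triple tensor product, so
  -- injectivity of `incl` brings the axiom down to it.
  have hl : ∀ u : A ⊗[ℂ] A, tmul (inl A c) 1 * comulTensorId Δ u =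
      incl ((A ⊗[ℂ] A) ⊗[ℂ] A)
        (T₂.toLinearMap.rTensor A ((TensorProduct.assoc ℂ A A A).symm (c ⊗ₜ u))) := by
    intro u
    induction u with
    | zero => simp
    | add x y hx hy => simp only [TensorProduct.tmul_add, map_add, mul_add, hx, hy]
    | tmul p q =>
      have : comulTensorId Δ (p ⊗ₜ q) = tmul (Δ p) (incl A q) := rfl
      rw [this, tmul_mul_tmul, one_mul, ← h₂', tmul_incl_incl]
      rfl
  have hr : ∀ v : A ⊗[ℂ] A, idTensorComul Δ v * tmul 1 (inr A b) =
      incl (A ⊗[ℂ] (A ⊗[ℂ] A))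
        (T₁.toLinearMap.lTensor A (TensorProduct.assoc ℂ A A A (v ⊗ₜ b))) := by
    intro v
    induction v with
    | zero => simp
    | add x y hx hy => simp only [TensorProduct.add_tmul, map_add, add_mul, hx, hy]
    | tmul p q =>
      have : idTensorComul Δ (p ⊗ₜ q) = tmul (incl A p) (Δ q) := rfl
      rw [this, tmul_mul_tmul, mul_one, ← h₁', tmul_incl_incl]
      rfl
  rw [← hr, ← hΔ.coassoc c y b _ _ (h₁' y b) (h₂' c y), hl, assocMultiplier, mapEquiv_incl]

theorem flipMultiplier_inl (a : A) : flipMultiplier A (inl A a) = inr A a := by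
  refine MultiplierAlgebra.ext (fun x => ?_) (fun x => ?_)
  · change TensorProduct.comm ℂ A A ((LinearMap.mulLeft ℂ a).rTensor A _) = _
    rw [← LinearMap.lTensor_comm]
    exact congrArg _ (LinearEquiv.apply_symm_apply _ _)
  · change TensorProduct.comm ℂ A A ((LinearMap.mulRight ℂ a).rTensor A _) = _
    rw [← LinearMap.lTensor_comm]
    exact congrArg _ (LinearEquiv.apply_symm_apply _ _)

theorem flipMultiplier_flipMultiplier (m : MultiplierAlgebra (A ⊗[ℂ] A)) :
    flipMultiplier A (flipMultiplier A m) = m := by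
  have h : ∀ x : A ⊗[ℂ] A, TensorProduct.comm ℂ A A (TensorProduct.comm ℂ A A x) = x :=
    (TensorProduct.comm ℂ A A).apply_symm_apply
  refine MultiplierAlgebra.ext (fun x => ?_) (fun x => ?_)
  · exact (h _).trans (congrArg m.left (h x))
  · exact (h _).trans (congrArg m.right (h x))

/-- The maps `y ⊗ b ↦ (1 ⊗ b)Δ(y)` and `c ⊗ y ↦ Δ(y)(c ⊗ 1)` as bijections of `A ⊗ A`. -/
theorem IsRegularMultiplierHopfAlgebra.exists_canonical_coopposite
    (hΔ : IsRegularMultiplierHopfAlgebra Δ) :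
    ∃ S₁ S₂ : A ⊗[ℂ] A ≃ₗ[ℂ] A ⊗[ℂ] A,
      (∀ y b, incl (A ⊗[ℂ] A) (S₁ (y ⊗ₜ b)) = inr A b * Δ y) ∧
      (∀ c y, incl (A ⊗[ℂ] A) (S₂ (c ⊗ₜ y)) = Δ y * inl A c) ∧
      ∀ c y b : A,
        S₂.toLinearMap.rTensor A ((TensorProduct.assoc ℂ A A A).symm (c ⊗ₜ S₁ (y ⊗ₜ b))) =
          (TensorProduct.assoc ℂ A A A).symm
            (S₁.toLinearMap.lTensor A (TensorProduct.assoc ℂ A A A (S₂ (c ⊗ₜ y) ⊗ₜ b))) := by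
  obtain ⟨T₁, T₂, h₁, h₂, h⟩ := hΔ.coopposite.exists_canonical
  let σ := TensorProduct.comm ℂ A A
  have flip_inr : ∀ a : A, flipMultiplier A (inr A a) = inl A a := fun a => by
    rw [← flipMultiplier_inl, flipMultiplier_flipMultiplier]
  have flip_coop : ∀ y, flipMultiplier A (_root_.coopposite Δ y) = Δ y := fun y =>
    flipMultiplier_flipMultiplier _
  refine ⟨σ.trans (T₂.trans σ), σ.trans (T₁.trans σ), fun y b => ?_, fun c y => ?_,
    fun c y b => ?_⟩
  · change incl _ (TensorProduct.comm ℂ A A (T₂ (b ⊗ₜ y))) = _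
    rw [← mapEquiv_incl _ (tensor_comm_mul A), h₂]
    change flipMultiplier A _ = _
    rw [map_mul, flipMultiplier_inl, flip_coop]
  · change incl _ (TensorProduct.comm ℂ A A (T₁ (y ⊗ₜ c))) = _
    rw [← mapEquiv_incl _ (tensor_comm_mul A), h₁]
    change flipMultiplier A _ = _
    rw [map_mul, flip_inr, flip_coop]
  -- `rev` reverses the three legs, `a ⊗ (b ⊗ c) ↦ (c ⊗ b) ⊗ a`. It carries coassociativity of `σΔ`
  -- to the required identity, with the roles of `T₁` and `T₂` exchanged.
  · let rev : A ⊗[ℂ] (A ⊗[ℂ] A) →ₗ[ℂ] (A ⊗[ℂ] A) ⊗[ℂ] A :=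
      (TensorProduct.comm ℂ A (A ⊗[ℂ] A)).toLinearMap ∘ₗ σ.toLinearMap.lTensor A
    have hl : ∀ u : A ⊗[ℂ] A, (σ.trans (T₁.trans σ)).toLinearMap.rTensor A
        ((TensorProduct.assoc ℂ A A A).symm (c ⊗ₜ σ u)) =
        rev (T₁.toLinearMap.lTensor A (TensorProduct.assoc ℂ A A A (u ⊗ₜ c))) := by
      intro u
      induction u with
      | zero => simp
      | add x y hx hy =>
        simp only [TensorProduct.add_tmul, TensorProduct.tmul_add, map_add] at hx hy ⊢
        rw [hx, hy]
      | tmul p q => simp [rev, σ]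
    have hr : ∀ v : A ⊗[ℂ] A, (TensorProduct.assoc ℂ A A A).symm
        ((σ.trans (T₂.trans σ)).toLinearMap.lTensor A (TensorProduct.assoc ℂ A A A (σ v ⊗ₜ b))) =
        rev (TensorProduct.assoc ℂ A A A (T₂.toLinearMap.rTensor A
          ((TensorProduct.assoc ℂ A A A).symm (b ⊗ₜ v)))) := by
      intro v
      induction v with
      | zero => simp
      | add x y hx hy =>
        simp only [TensorProduct.add_tmul, TensorProduct.tmul_add, map_add] at hx hy ⊢
        rw [hx, hy]
      | tmul p q =>
        simp only [σ, TensorProduct.comm_tmul, TensorProduct.assoc_tmul, LinearMap.lTensor_tmul,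
          TensorProduct.assoc_symm_tmul, LinearMap.rTensor_tmul, LinearEquiv.coe_coe,
          LinearEquiv.trans_apply]
        generalize T₂ (b ⊗ₜ p) = t
        induction t with
        | zero => simp
        | add x y hx hy => simp only [TensorProduct.add_tmul, TensorProduct.tmul_add, map_add, hx, hy]
        | tmul r s => simp [rev, σ]
    have h' := congrArg (fun z => rev (TensorProduct.assoc ℂ A A A z)) (h b y c)
    simp only [LinearEquiv.apply_symm_apply] at h'
    change _ = rev _ at h'
    exact (hl (T₂ (b ⊗ₜ y))).trans (h'.symm.trans (hr (T₁ (y ⊗ₜ c))).symm)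

/-- `HasSlice` only provides some representative in `A ⊗ A`; injectivity of `incl` makes it the
given one. -/
theorem IsLeftIntegral.sliceRight_of_incl_eq_mul_inl {φ : A →ₗ[ℂ] ℂ} (hφ : IsLeftIntegral Δ φ)
    (hinj : Function.Injective (incl (A ⊗[ℂ] A))) {a b : A} {x : A ⊗[ℂ] A}
    (hx : incl (A ⊗[ℂ] A) x = Δ a * inl A b) : sliceRight A φ x = φ a • b := by
  obtain ⟨u, hu, h⟩ := (hφ.invariant a b).1
  rw [hinj (hx.trans hu.symm)]
  exact h.symm

theorem IsLeftIntegral.sliceRight_of_incl_eq_inl_mul {φ : A →ₗ[ℂ] ℂ} (hφ : IsLeftIntegral Δ φ)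
    (hinj : Function.Injective (incl (A ⊗[ℂ] A))) {a b : A} {x : A ⊗[ℂ] A}
    (hx : incl (A ⊗[ℂ] A) x = inl A b * Δ a) : sliceRight A φ x = φ a • b := by
  obtain ⟨u, hu, h⟩ := (hφ.invariant a b).2
  rw [hinj (hx.trans hu.symm)]
  exact h.symm

/-- A left integral on a regular multiplier Hopf algebra is faithful. -/
theorem IsLeftIntegral.isFaithfulFunctional (hΔ : IsRegularMultiplierHopfAlgebra Δ)
    {φ : A →ₗ[ℂ] ℂ} (hφ : IsLeftIntegral Δ φ) : IsFaithfulFunctional φ := by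
  obtain ⟨T₁, T₂, hT₁, hT₂, hT⟩ := hΔ.exists_canonical
  obtain ⟨S₁, S₂, hS₁, hS₂, hS⟩ := hΔ.exists_canonical_coopposite
  have hinj := hΔ.incl_injective
  have comm : ∀ a b : A, inl A a * inr A b = inr A b * inl A a := fun a b => by
    rw [inl_mul_inr, inr_mul_inl]
  constructor
  -- For the opposite product with the same `Δ`, the canonical maps are `S₁` and `S₂`, and `D` comes
  -- from `T₁`. Left invariance is two-sided in the covering element, so it survives.
  · refine fun y => eq_zero_of_functional_mul (LinearMap.mul ℂ A).flip
      (fun a b c => (mul_assoc c b a).symm) hΔ.nondegenerate.2 hΔ.nondegenerate.1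
      S₁.toLinearMap S₂ S₁.surjective hS (fun c y b => hinj ?_)
      (fun b => T₁.toLinearMap ∘ₗ (TensorProduct.mk ℂ A A).flip b) (fun b y c => hinj ?_)
      (fun b y d => hinj ?_) φ hφ.ne_zero (fun y hy b => ?_) y
    · exact (incl_mul_inl _ _).symm.trans ((by rw [hS₁, hS₂, mul_assoc] :
        incl _ (S₁ (y ⊗ₜ b)) * inl A c = inr A b * incl _ (S₂ (c ⊗ₜ y))).trans (inr_mul_incl _ _))
    · exact (inr_mul_incl _ _).symm.trans ((by rw [hT₁, hS₁, mul_assoc] :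
        inr A c * incl _ (T₁ (y ⊗ₜ b)) = incl _ (S₁ (y ⊗ₜ c)) * inr A b).trans (incl_mul_inr _ _))
    · exact (incl_mul_inl _ _).symm.trans ((by rw [hT₁, hS₂, mul_assoc, mul_assoc, comm] :
        incl _ (T₁ (y ⊗ₜ b)) * inl A d = incl _ (S₂ (d ⊗ₜ y)) * inr A b).trans (incl_mul_inr _ _))
    -- Every `w` is a sum of terms `Δ(b)(c ⊗ 1)`, and `Δ(y)Δ(b)(c ⊗ 1) = Δ(yb)(c ⊗ 1)` has slice
    -- `φ(yb)c = 0`.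
    · have key : ∀ w : A ⊗[ℂ] A, sliceRight A φ ((Δ y).left w) = 0 := by
        intro w
        obtain ⟨z, rfl⟩ := S₂.surjective w
        induction z with
        | zero => simp
        | add z z' hz hz' => rw [map_add, map_add, map_add, hz, hz', add_zero]
        | tmul c b =>
          rw [hφ.sliceRight_of_incl_eq_mul_inl hinj (a := y * b) (b := c)]
          · rw [show φ (y * b) = 0 from hy b, zero_smul]
          · rw [← mul_incl, hS₂, ← mul_assoc, map_mul]
      refine hΔ.nondegenerate.1 _ fun d => ?_
      rw [← LinearMap.mulRight_apply (R := ℂ), comp_sliceRight, ← key (d ⊗ₜ b)]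
      refine congrArg _ (hinj ?_)
      rw [← incl_mul_inl, ← mul_incl, ← inr_mul_inl, ← mul_assoc, ← hT₁]
      rfl
  · refine fun y => eq_zero_of_functional_mul (LinearMap.mul ℂ A)
      mul_assoc hΔ.nondegenerate.1 hΔ.nondegenerate.2
      T₁.toLinearMap T₂ T₁.surjective hT (fun c y b => hinj ?_)
      (fun b => S₁.toLinearMap ∘ₗ (TensorProduct.mk ℂ A A).flip b) (fun b y c => hinj ?_)
      (fun b y d => hinj ?_) φ hφ.ne_zero (fun y hy b => ?_) y
    · exact (inl_mul_incl _ _).symm.trans ((by rw [hT₁, hT₂, mul_assoc] :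
        inl A c * incl _ (T₁ (y ⊗ₜ b)) = incl _ (T₂ (c ⊗ₜ y)) * inr A b).trans (incl_mul_inr _ _))
    · exact (incl_mul_inr _ _).symm.trans ((by rw [hT₁, hS₁, mul_assoc] :
        incl _ (S₁ (y ⊗ₜ b)) * inr A c = inr A b * incl _ (T₁ (y ⊗ₜ c))).trans (inr_mul_incl _ _))
    · exact (inl_mul_incl _ _).symm.trans ((by rw [hS₁, hT₂, ← mul_assoc, ← mul_assoc, comm] :
        inl A d * incl _ (S₁ (y ⊗ₜ b)) = inr A b * incl _ (T₂ (d ⊗ₜ y))).trans (inr_mul_incl _ _))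
    · have key : ∀ w : A ⊗[ℂ] A, sliceRight A φ ((Δ y).right w) = 0 := by
        intro w
        obtain ⟨z, rfl⟩ := T₂.surjective w
        induction z with
        | zero => simp
        | add z z' hz hz' => rw [map_add, map_add, map_add, hz, hz', add_zero]
        | tmul c b =>
          rw [hφ.sliceRight_of_incl_eq_inl_mul hinj (a := b * y) (b := c)]
          · rw [show φ (b * y) = 0 from hy b, zero_smul]
          · rw [← incl_mul, hT₂, mul_assoc, map_mul]
      refine hΔ.nondegenerate.2 _ fun d => ?_
      rw [← LinearMap.mulLeft_apply (R := ℂ), comp_sliceRight, ← key (d ⊗ₜ b)]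
      refine congrArg _ (hinj ?_)
      rw [← inl_mul_incl, ← incl_mul, ← inl_mul_inr, mul_assoc, ← hS₁]
      rfl

end MultiplierHopfMaps

/-! ### Compression of multipliers to a direct factor -/

section Compress

variable {A B : Type*} [NonUnitalRing A] [Module ℂ A] [IsScalarTower ℂ A A] [SMulCommClass ℂ A A]
  [NonUnitalRing B] [Module ℂ B] [IsScalarTower ℂ B B] [SMulCommClass ℂ B B]

namespace MultiplierAlgebra

variable (i : B →ₗ[ℂ] A) (π : A →ₗ[ℂ] B) (hi : ∀ x y, i (x * y) = i x * i y)
  (hπ : ∀ x y, π (x * y) = π x * π y) (hπi : ∀ x, π (i x) = x)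

theorem compress_incl (a : A) : compress i π hi hπ hπi (incl A a) = incl B (π a) :=
  ext (fun x => (hπ a (i x)).trans (by rw [hπi]; rfl))
    (fun x => (hπ (i x) a).trans (by rw [hπi]; rfl))

/-- Compression respects a product when the right factor restricts along `i` in its left action and
descends along `π` in its right action. -/
theorem compress_mul (m : MultiplierAlgebra A) {n : MultiplierAlgebra A} {n' : MultiplierAlgebra B}
    (hl : ∀ x, n.left (i x) = i (n'.left x)) (hr : ∀ x, π (n.right x) = n'.right (π x)) :
    compress i π hi hπ hπi (m * n) = compress i π hi hπ hπi m * n' :=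
  ext (fun x => congrArg (fun z => π (m.left z)) (hl x)) (fun x => hr (m.right (i x)))

theorem mul_compress (m : MultiplierAlgebra A) {n : MultiplierAlgebra A}
    {n' : MultiplierAlgebra B}
    (hl : ∀ x, π (n.left x) = n'.left (π x)) (hr : ∀ x, n.right (i x) = i (n'.right x)) :
    compress i π hi hπ hπi (n * m) = n' * compress i π hi hπ hπi m :=
  ext (fun x => hl (m.left (i x))) (fun x => congrArg (fun z => π (m.right z)) (hr x))

end MultiplierAlgebra

end Compress

/-! ### Components of a cograded multiplier Hopf algebra -/

namespace Cograding

open MultiplierAlgebra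

variable {A G : Type*} [NonUnitalRing A] [Module ℂ A] [IsScalarTower ℂ A A] [SMulCommClass ℂ A A]
  [Group G] {Δ : A →ₙₐ[ℂ] MultiplierAlgebra (A ⊗[ℂ] A)} (𝒜 : Cograding G Δ)

/-- The projection of `A` on its direct summand `A_p`, as an endomorphism of `A`. -/
noncomputable def partProj (p : G) : A →ₗ[ℂ] A := 𝒜.ι p ∘ₗ 𝒜.proj p

theorem partProj_mem (p : G) (a : A) : 𝒜.partProj p a ∈ 𝒜.part p := (𝒜.proj p a).2

theorem partProj_of_mem {p : G} {a : A} (ha : a ∈ 𝒜.part p) : 𝒜.partProj p a = a :=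
  congrArg Subtype.val (𝒜.proj_self p ⟨a, ha⟩)

theorem partProj_of_ne {p q : G} (h : q ≠ p) {a : A} (ha : a ∈ 𝒜.part q) :
    𝒜.partProj p a = 0 :=
  congrArg Subtype.val (𝒜.proj_of_ne h ⟨a, ha⟩)

theorem partProj_mul (p : G) (a b : A) :
    𝒜.partProj p (a * b) = 𝒜.partProj p a * 𝒜.partProj p b :=
  congrArg Subtype.val (𝒜.proj_mul p a b)

/-- `partProj p` behaves as multiplication by a central idempotent: a component `A_r` with `r ≠ p`
annihilates `A_p`, so both sides see only the `p`-component of `c`. -/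
theorem mul_partProj (p : G) (c x : A) : c * 𝒜.partProj p x = 𝒜.partProj p (c * x) := by
  rw [partProj_mul]
  induction c using 𝒜.induction_on with
  | zero => simp
  | add a b ha hb => rw [map_add, add_mul, add_mul, ha, hb]
  | part r c =>
    by_cases h : r = p
    · subst h
      rw [𝒜.partProj_of_mem c.2]
    · rw [𝒜.partProj_of_ne h c.2, zero_mul, 𝒜.mul_eq_zero r p h _ c.2 _ (𝒜.partProj_mem p x)]

theorem partProj_mul_right (p : G) (x c : A) : 𝒜.partProj p x * c = 𝒜.partProj p (x * c) := by
  rw [partProj_mul]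
  induction c using 𝒜.induction_on with
  | zero => simp
  | add a b ha hb => rw [map_add, mul_add, mul_add, ha, hb]
  | part r c =>
    by_cases h : r = p
    · subst h
      rw [𝒜.partProj_of_mem c.2]
    · rw [𝒜.partProj_of_ne h c.2, mul_zero,
        𝒜.mul_eq_zero p r (Ne.symm h) _ (𝒜.partProj_mem p x) _ c.2]

theorem mul_eq_mul_partProj {p : G} {a : A} (ha : a ∈ 𝒜.part p) (b : A) :
    a * b = a * 𝒜.partProj p b := by
  rw [mul_partProj, ← partProj_mul_right, 𝒜.partProj_of_mem ha]

theorem mul_eq_partProj_mul {p : G} {a : A} (ha : a ∈ 𝒜.part p) (b : A) :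
    b * a = 𝒜.partProj p b * a := by
  rw [partProj_mul_right, ← mul_partProj, 𝒜.partProj_of_mem ha]

/-- The restrictions of a faithful functional to the components are faithful. -/
theorem isFaithfulFunctional_functional {φ : A →ₗ[ℂ] ℂ} (hφ : IsFaithfulFunctional φ) (p : G) :
    IsFaithfulFunctional (𝒜.functional φ p) := by
  refine ⟨fun a h => Subtype.ext (hφ.1 a fun b => ?_), fun a h => Subtype.ext (hφ.2 a fun b => ?_)⟩
  · rw [𝒜.mul_eq_mul_partProj a.2]
    exact h (𝒜.proj p b)
  · rw [𝒜.mul_eq_partProj_mul a.2]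
    exact h (𝒜.proj p b)

theorem map_partProj_of_mem_subTensor (hinj : Function.Injective (incl (A ⊗[ℂ] A))) {p q : G}
    {x : A ⊗[ℂ] A} (hx : incl (A ⊗[ℂ] A) x ∈ subTensor (𝒜.part p) (𝒜.part q)) :
    TensorProduct.map (𝒜.partProj p) (𝒜.partProj q) x = x := by
  have h : ∀ m ∈ subTensor (𝒜.part p) (𝒜.part q), ∃ y : A ⊗[ℂ] A, incl (A ⊗[ℂ] A) y = m ∧
      TensorProduct.map (𝒜.partProj p) (𝒜.partProj q) y = y := by
    intro m hm
    induction hm using Submodule.span_induction with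
    | mem m hm =>
      obtain ⟨a, ha, b, hb, rfl⟩ := hm
      refine ⟨a ⊗ₜ b, rfl, ?_⟩
      rw [TensorProduct.map_tmul, 𝒜.partProj_of_mem ha, 𝒜.partProj_of_mem hb]
    | zero => exact ⟨0, map_zero _, map_zero _⟩
    | add m n _ _ hm hn =>
      obtain ⟨x, rfl, hx⟩ := hm
      obtain ⟨y, rfl, hy⟩ := hn
      exact ⟨x + y, map_add _ _ _, by rw [map_add, hx, hy]⟩
    | smul r m _ hm =>
      obtain ⟨x, rfl, hx⟩ := hm
      exact ⟨r • x, map_smul _ _ _, by rw [map_smul, hx]⟩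
  obtain ⟨y, hy, hy'⟩ := h _ hx
  rwa [hinj hy] at hy'

theorem map_partProj_of_incl_eq_inl_mul (hinj : Function.Injective (incl (A ⊗[ℂ] A))) {p q : G}
    {a b : A} (ha : a ∈ 𝒜.part (p * q)) (hb : b ∈ 𝒜.part p) {x : A ⊗[ℂ] A}
    (hx : incl (A ⊗[ℂ] A) x = inl A b * Δ a) :
    TensorProduct.map (𝒜.partProj p) (𝒜.partProj q) x = x := by
  refine 𝒜.map_partProj_of_mem_subTensor hinj ?_
  rw [← 𝒜.comul_left, hx]
  exact Submodule.subset_span ⟨b, hb, a, ha, rfl⟩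

theorem map_partProj_of_incl_eq_mul_inl (hΔ : IsMultiplierHopfAlgebra Δ) {p q : G}
    {a b : A} (ha : a ∈ 𝒜.part (p * q)) (hb : b ∈ 𝒜.part p) {x : A ⊗[ℂ] A}
    (hx : incl (A ⊗[ℂ] A) x = Δ a * inl A b) :
    TensorProduct.map (𝒜.partProj p) (𝒜.partProj q) x = x := by
  have hinj := hΔ.incl_injective
  have left_comm : ∀ c : A, ∀ z : A ⊗[ℂ] A, (LinearMap.mulLeft ℂ c).rTensor A
      (TensorProduct.map (𝒜.partProj p) (𝒜.partProj q) z) =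
      TensorProduct.map (𝒜.partProj p) (𝒜.partProj q) ((LinearMap.mulLeft ℂ c).rTensor A z) := by
    intro c z
    rw [← LinearMap.comp_apply, ← LinearMap.comp_apply]
    congr 1
    ext u v
    simp [mul_partProj]
  have right_comm : ∀ z : A ⊗[ℂ] A, (LinearMap.mulRight ℂ b).rTensor A
      (TensorProduct.map (𝒜.partProj p) (𝒜.partProj q) z) =
      TensorProduct.map (𝒜.partProj p) (𝒜.partProj q) ((LinearMap.mulRight ℂ b).rTensor A z) := by
    intro z
    rw [← LinearMap.comp_apply, ← LinearMap.comp_apply]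
    congr 1
    ext u v
    simp [partProj_mul_right]
  refine sub_eq_zero.1 (eq_zero_of_rTensor (f := fun c : A => LinearMap.mulLeft ℂ c)
    hΔ.nondegenerate.2 fun c => ?_)
  rw [map_sub, sub_eq_zero, left_comm]
  induction c using 𝒜.induction_on with
  | zero => simp
  | add c d hc hd =>
    have : LinearMap.mulLeft ℂ (c + d) = LinearMap.mulLeft ℂ c + LinearMap.mulLeft ℂ d :=
      LinearMap.ext fun x => add_mul c d x
    rw [this, LinearMap.rTensor_add, LinearMap.add_apply, map_add, hc, hd]
  | part r c =>
    -- The cograding controls `(c ⊗ 1)Δ(a)`, not `Δ(a)(b ⊗ 1)`. For `c ∈ A_r` the former lies in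
    -- `A_r ⊗ A_s` with `s = r⁻¹pq`. Multiplied by `b ⊗ 1` on the right it vanishes if `r ≠ p`, and
    -- `s = q` if `r = p`.
    obtain ⟨w, hw⟩ := hΔ.cover₂ (c : A) a
    have hcx : (LinearMap.mulLeft ℂ (c : A)).rTensor A x = (LinearMap.mulRight ℂ b).rTensor A w := by
      apply hinj
      rw [← inl_mul_incl, ← incl_mul_inl, hx, ← mul_assoc, ← hw]
      rfl
    have hproj : TensorProduct.map (𝒜.partProj r) (𝒜.partProj (r⁻¹ * (p * q))) w = w :=
      𝒜.map_partProj_of_incl_eq_inl_mul hinj (by rwa [mul_inv_cancel_left]) c.2 hw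
    rw [hcx]
    by_cases h : r = p
    · subst h
      rw [inv_mul_cancel_left] at hproj
      rw [← right_comm, hproj]
    · suffices (LinearMap.mulRight ℂ b).rTensor A w = 0 by rw [this, map_zero]
      rw [← hproj, LinearMap.rTensor_map]
      have : LinearMap.mulRight ℂ b ∘ₗ 𝒜.partProj r = 0 :=
        LinearMap.ext fun u => 𝒜.mul_eq_zero r p h _ (𝒜.partProj_mem r u) _ hb
      rw [this, TensorProduct.map_zero_left, LinearMap.zero_apply]

theorem coe_idTensor_functional (φ : A →ₗ[ℂ] ℂ) {p q : G} {x : A ⊗[ℂ] A}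
    (hx : TensorProduct.map (𝒜.partProj p) (𝒜.partProj q) x = x) :
    𝒜.ι p (idTensor (𝒜.functional φ q) (TensorProduct.map (𝒜.proj p) (𝒜.proj q) x)) =
      sliceRight A φ x := by
  conv_rhs => rw [← hx]
  have : 𝒜.ι p ∘ₗ idTensor (𝒜.functional φ q) ∘ₗ TensorProduct.map (𝒜.proj p) (𝒜.proj q) =
      sliceRight A φ ∘ₗ TensorProduct.map (𝒜.partProj p) (𝒜.partProj q) := by
    ext u v
    simp [idTensor, functional, partProj]
  exact LinearMap.congr_fun this x

theorem multiplierComponent_incl (p q : G) (x : A ⊗[ℂ] A) :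
    𝒜.multiplierComponent p q (incl (A ⊗[ℂ] A) x) =
      incl (𝒜.part p ⊗[ℂ] 𝒜.part q) (TensorProduct.map (𝒜.proj p) (𝒜.proj q) x) :=
  compress_incl _ _ _ _ _ x

theorem multiplierComponent_mul_inl (p q : G) (m : MultiplierAlgebra (A ⊗[ℂ] A)) (b : 𝒜.part p) :
    𝒜.multiplierComponent p q (m * inl A (b : A)) =
      𝒜.multiplierComponent p q m * inl (𝒜.part q) b := by
  refine compress_mul _ _ _ _ _ m (fun x => ?_) (fun x => ?_)
  · rw [left_inl, left_inl, ← LinearMap.comp_apply, ← LinearMap.comp_apply]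
    congr 1
    ext u v
    simp [ι_apply]
  · rw [right_inl, right_inl, ← LinearMap.comp_apply, ← LinearMap.comp_apply]
    congr 1
    ext u v : 3
    simp [proj_mul, proj_self]

theorem multiplierComponent_inl_mul (p q : G) (m : MultiplierAlgebra (A ⊗[ℂ] A)) (b : 𝒜.part p) :
    𝒜.multiplierComponent p q (inl A (b : A) * m) =
      inl (𝒜.part q) b * 𝒜.multiplierComponent p q m := by
  refine mul_compress _ _ _ _ _ m (fun x => ?_) (fun x => ?_)
  · rw [left_inl, left_inl, ← LinearMap.comp_apply, ← LinearMap.comp_apply]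
    congr 1
    ext u v : 3
    simp [proj_mul, proj_self]
  · rw [right_inl, right_inl, ← LinearMap.comp_apply, ← LinearMap.comp_apply]
    congr 1
    ext u v
    simp [ι_apply]

/-- The components of a left integral satisfy `(ι ⊗ φ_q)(Δ_{p,q}(a)) = φ_{pq}(a) 1_p`. -/
theorem hasSlice_comul (hΔ : IsMultiplierHopfAlgebra Δ) {φ : A →ₗ[ℂ] ℂ} (hφ : IsLeftIntegral Δ φ)
    (p q : G) (a : 𝒜.part (p * q)) :
    HasSlice (𝒜.functional φ q) (𝒜.comul p q a)
      (𝒜.functional φ (p * q) a • (1 : MultiplierAlgebra (𝒜.part p))) := by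
  intro b
  have hinj := hΔ.incl_injective
  -- Invariance on `A` supplies `Δ(a)(b ⊗ 1)` and `(b ⊗ 1)Δ(a)` as elements of `A ⊗ A`; their `(p,
  -- q)`-components are the witnesses, and projecting loses nothing.
  obtain ⟨⟨u, hu, -⟩, ⟨v, hv, -⟩⟩ := hφ.invariant a b
  refine ⟨⟨TensorProduct.map (𝒜.proj p) (𝒜.proj q) u, ?_, Subtype.ext ?_⟩,
    ⟨TensorProduct.map (𝒜.proj p) (𝒜.proj q) v, ?_, Subtype.ext ?_⟩⟩
  · rw [← multiplierComponent_incl, hu, multiplierComponent_mul_inl]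
    rfl
  · refine Eq.trans ?_ (𝒜.coe_idTensor_functional φ
      (𝒜.map_partProj_of_incl_eq_mul_inl hΔ a.2 b.2 hu)).symm
    rw [hφ.sliceRight_of_incl_eq_mul_inl hinj hu]
    rfl
  · rw [← multiplierComponent_incl, hv, multiplierComponent_inl_mul]
    rfl
  · refine Eq.trans ?_ (𝒜.coe_idTensor_functional φ
      (𝒜.map_partProj_of_incl_eq_inl_mul hinj a.2 b.2 hv)).symm
    rw [hφ.sliceRight_of_incl_eq_inl_mul hinj hv]
    rfl

end Cograding

theorem proposition2p4 {A G : Type*} [NonUnitalRing A] [Module ℂ A] [IsScalarTower ℂ A A]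
    [SMulCommClass ℂ A A] [Group G] (Δ : A →ₙₐ[ℂ] MultiplierAlgebra (A ⊗[ℂ] A))
    (hΔ : IsRegularMultiplierHopfAlgebra Δ) (𝒜 : Cograding G Δ)
    (φ : A →ₗ[ℂ] ℂ) (hφ : IsLeftIntegral Δ φ) :
    (∀ p : G, IsFaithfulFunctional (𝒜.functional φ p)) ∧
    ∀ (p q : G) (a : 𝒜.part (p * q)),
      MultiplierAlgebra.HasSlice (𝒜.functional φ q) (𝒜.comul p q a)
        (𝒜.functional φ (p * q) a • (1 : MultiplierAlgebra (𝒜.part p))) :=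
  ⟨𝒜.isFaithfulFunctional_functional (hφ.isFaithfulFunctional hΔ),
    𝒜.hasSlice_comul hΔ.toIsMultiplierHopfAlgebra hφ⟩
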